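/- **Setting.** A symmetry type $\mathsf S$ is one of the ten types A, D, C, AI, AII, AIII, BDI, CI, CII, DIII of the tenfold way: none, one or all three of a particle-hole symmetry $\eta$ (antiunitary), a time-reversal symmetry $\tau$ (antiunitary) and a chiral symmetry $\gamma$ (unitary), with prescribed signs of the squares: $\eta^2=1$ (D), $\eta^2=-1$ (C), $\tau^2=1$ (AI), $\tau^2=-1$ (AII), $\gamma^2=1$ (AIII), and $(\eta^2,\tau^2,\gamma^2)=(1,1,1)$ (BDI), $(-1,1,-1)$ (CI), $(-1,-1,1)$ (CII), $(1,-1,-1)$ (DIII), where $\eta\tau=\tau\eta=\gamma$ if all three are present. A representation of $\mathsf S$ on a Hilbert space consists of operators with these properties. A bounded operator $W$ satisfies the symmetries if $\eta W=W\eta$, $\tau W=W^*\tau$, $\gamma W=W^*\gamma$ for those present. A finite-dimensional representation is balanced if some unitary $U$ that satisfies the symmetries has neither $1$ nor $-1$ as an eigenvalue. The index group $I(\mathsf S)$ is the abelian group (under direct sum) of finite-dimensional representations modulo $\rho_1\sim\rho_2\iff\rho_1\oplus\beta_1\cong\rho_2\oplus\beta_2$ (unitary equivalence) for some balanced $\beta_1,\beta_2$;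 $\mathrm{si}(\rho)$ denotes the class of $\rho$. A bounded operator $W$ is an *admissible essentially unitary* operator if $W^*W-1$ and $WW^*-1$ are compact, $W$ satisfies the symmetries, and there are bounded $R_{\pm1}$ such that $R_1(W-1)-1$ and $R_{-1}(W+1)-1$ are compact. Then the kernel of $\operatorname{Im}W=\frac1{2i}(W-W^*)$ is finite-dimensional and invariant under the symmetries, and $\mathrm{si}(W)\in I(\mathsf S)$ is the class of the representation on it. Let $\mathcal H=\bigoplus_{x\in\mathbb Z}\mathcal H_x$ be a Hilbert space direct sum of cells of finite non-zero dimension, with a representation of $\mathsf S$ that maps each cell to itself and is balanced on each cell. Let $P_{\ge a}$ and $P_{<a}$ be the orthogonal projections onto $\bigoplus_{x\ge a}\mathcal H_x$ and $\bigoplus_{x<a}\mathcal H_x$. A *walk* is an admissible essentially unitary operator $W$ on $\mathcal H$ that is essentially local: $P_{\ge a}WP_{<a}$ and $P_{<a}WP_{\ge a}$ are compact for some $a\in\mathbb Z$. A walk $W'$ is a gentle perturbation of $W$ if a norm-continuous path of walks, parametrised by $[0,1]$, leads from $W$ to $W'$; a compact perturbation if $W'-W$ is compact; a local perturbation if $W'-W$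 is non-zero only on finitely many cells. **Theorem.** Let $W$ be a walk. For every $a\in\mathbb Z$ the operators $P_{<a}WP_{<a}$ on $P_{<a}\mathcal H$ and $P_{\ge a}WP_{\ge a}$ on $P_{\ge a}\mathcal H$ are admissible essentially unitary, so that $\mathrm{si}^{\leftarrow}_a(W)=\mathrm{si}(P_{<a}WP_{<a})$ and $\mathrm{si}^{\rightarrow}_a(W)=\mathrm{si}(P_{\ge a}WP_{\ge a})$ are defined, and: 1. If a walk $W'$ is a gentle or a compact perturbation of $W$, then $\mathrm{si}(W')=\mathrm{si}(W)$, $\mathrm{si}^{\leftarrow}_a(W')=\mathrm{si}^{\leftarrow}_a(W)$ and $\mathrm{si}^{\rightarrow}_a(W')=\mathrm{si}^{\rightarrow}_a(W)$ for all $a$. 2. $\mathrm{si}(W)=\mathrm{si}^{\leftarrow}_a(W)+\mathrm{si}^{\rightarrow}_a(W)$ for all $a$. 3. $\mathrm{si}^{\leftarrow}_a(W)$ and $\mathrm{si}^{\rightarrow}_a(W)$ do not depend on $a$. 4. If a walk $W'=W_L\oplus W_R$, decoupled with respect to $\mathcal H=P_{<a}\mathcal H\oplus P_{\ge a}\mathcal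 H$ for some $a$, is a local perturbation of $W$, then $W_L$ and $W_R$ are admissible essentially unitary and $\mathrm{si}^{\leftarrow}_b(W)=\mathrm{si}(W_L)$, $\mathrm{si}^{\rightarrow}_b(W)=\mathrm{si}(W_R)$ for all $b$. 5. If $W$ is translation invariant, i.e. there is a unitary $T$ with $T\mathcal H_x=\mathcal H_{x+1}$ for all $x$ that commutes with $W$ and with all symmetries, then $\mathrm{si}(W)=0$. -/

import Mathlib

namespace SymWalk

noncomputable section

universe u

/-! ### Symmetry types and their representations -/

/-- The three kinds of symmetries: particle-hole (`eta`), time reversal (`tau`), chiral (`chi`). -/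
inductive Sym
  | eta
  | tau
  | chi

/-- Particle-hole and time reversal symmetries are antilinear, the chiral one is linear. -/
def Sym.twist : Sym → (ℂ →+* ℂ)
  | .eta => starRingEnd ℂ
  | .tau => starRingEnd ℂ
  | .chi => RingHom.id ℂ

/-- The ten symmetry types of the tenfold way. -/
inductive SymType
  | A
  | D
  | C
  | AI
  | AII
  | AIII
  | BDI
  | CI
  | CII
  | DIII

/-- The sign `± 1` to which each symmetry squares; `none` if the symmetry is not part of the
type. -/
def SymType.sq : SymType → Sym → Option ℤ
  | .A, _ => none
  | .D, .eta => some 1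
  | .D, _ => none
  | .C, .eta => some (-1)
  | .C, _ => none
  | .AI, .tau => some 1
  | .AI, _ => none
  | .AII, .tau => some (-1)
  | .AII, _ => none
  | .AIII, .chi => some 1
  | .AIII, _ => none
  | .BDI, _ => some 1
  | .CI, .tau => some 1
  | .CI, _ => some (-1)
  | .CII, .chi => some 1
  | .CII, _ => some (-1)
  | .DIII, .eta => some 1
  | .DIII, _ => some (-1)

/-- A representation of the symmetry type `S` on `V`: for every symmetry in the type a linear or
antilinear isometry squaring to the prescribed sign (hence surjective, i.e. unitary or
antiunitary).  If all three symmetries are present, they satisfy `η τ = τ η = γ`, which implies that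
they all commute. -/
structure SymRep (S : SymType) (V : Type u) [NormedAddCommGroup V] [InnerProductSpace ℂ V] where
  op : ∀ s : Sym, (S.sq s).isSome → V →ₛₗᵢ[s.twist] V
  op_sq : ∀ (s : Sym) (h : (S.sq s).isSome) (v : V), op s h (op s h v) = (S.sq s).get h • v
  eta_tau : ∀ (h₁ : (S.sq .eta).isSome) (h₂ : (S.sq .tau).isSome) (h₃ : (S.sq .chi).isSome) (v : V),
    op .eta h₁ (op .tau h₂ v) = op .chi h₃ v
  tau_eta : ∀ (h₁ : (S.sq .eta).isSome) (h₂ : (S.sq .tau).isSome) (h₃ : (S.sq .chi).isSome) (v : V),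
    op .tau h₂ (op .eta h₁ v) = op .chi h₃ v

theorem pair_ext {V₁ V₂ : Type u} {v w : WithLp 2 (V₁ × V₂)} (h₁ : v.fst = w.fst)
    (h₂ : v.snd = w.snd) : v = w :=
  WithLp.ofLp_injective 2 (Prod.ext h₁ h₂)

theorem eq_zero_of_eq_neg {V : Type u} [NormedAddCommGroup V] [InnerProductSpace ℂ V] {v : V}
    (h : v = -v) : v = 0 := by
  have h2 : (2 : ℂ) • v = 0 := by
    rw [two_smul]
    nth_rewrite 2 [h]
    exact add_neg_cancel v
  simpa using h2

section Rep

variable {S : SymType} {V V₁ V₂ V₃ V₄ : Type u}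
  [NormedAddCommGroup V] [InnerProductSpace ℂ V]
  [NormedAddCommGroup V₁] [InnerProductSpace ℂ V₁]
  [NormedAddCommGroup V₂] [InnerProductSpace ℂ V₂]
  [NormedAddCommGroup V₃] [InnerProductSpace ℂ V₃]
  [NormedAddCommGroup V₄] [InnerProductSpace ℂ V₄]

/-- The symmetry relations for an operator `W` with adjoint `W'`:
`η W η* = W`, `τ W τ* = W'`, `γ W γ* = W'`. -/
def SymRep.Intertwines (ρ : SymRep S V) (W W' : V → V) : Prop :=
  (∀ h v, ρ.op .eta h (W v) = W (ρ.op .eta h v)) ∧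
  (∀ h v, ρ.op .tau h (W v) = W' (ρ.op .tau h v)) ∧
  (∀ h v, ρ.op .chi h (W v) = W' (ρ.op .chi h v))

/-- The subspace `K` is invariant under all symmetry operators. -/
def SymRep.Leaves (ρ : SymRep S V) (K : Submodule ℂ V) : Prop :=
  ∀ (s : Sym) (h : (S.sq s).isSome), ∀ v ∈ K, ρ.op s h v ∈ K

/-- The restriction of a symmetry representation to an invariant subspace. -/
def SymRep.restrict (ρ : SymRep S V) (K : Submodule ℂ V) (hK : ρ.Leaves K) : SymRep S K where
  op s h :=
    { toFun := fun v => ⟨ρ.op s h v, hK s h v v.2⟩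
      map_add' := fun v w => Subtype.ext ((ρ.op s h).map_add v w)
      map_smul' := fun c v => Subtype.ext ((ρ.op s h).map_smulₛₗ c v)
      norm_map' := fun v => (ρ.op s h).norm_map v }
  op_sq s h v := Subtype.ext (ρ.op_sq s h v)
  eta_tau h₁ h₂ h₃ v := Subtype.ext (ρ.eta_tau h₁ h₂ h₃ v)
  tau_eta h₁ h₂ h₃ v := Subtype.ext (ρ.tau_eta h₁ h₂ h₃ v)

/-- A representation on a finite-dimensional space is balanced if there is a unitary operator `U`
which satisfies the symmetry relations and is gapped, i.e. does not have the eigenvalues `± 1`. -/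
def SymRep.IsBalanced (ρ : SymRep S V) : Prop :=
  ∃ U : V ≃ₗᵢ[ℂ] V, ρ.Intertwines U U.symm ∧ (∀ v, U v = v → v = 0) ∧ (∀ v, U v = -v → v = 0)

/-- Unitary equivalence of representations. -/
def SymRep.UEquiv (ρ₁ : SymRep S V₁) (ρ₂ : SymRep S V₂) : Prop :=
  ∃ U : V₁ ≃ₗᵢ[ℂ] V₂, ∀ (s : Sym) (h : (S.sq s).isSome) (v : V₁),
    U (ρ₁.op s h v) = ρ₂.op s h (U v)

/-- The (orthogonal) direct sum of two representations. -/
def SymRep.sum (ρ₁ : SymRep S V₁) (ρ₂ : SymRep S V₂) : SymRep S (WithLp 2 (V₁ × V₂)) where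
  op s h :=
    { toFun := fun v => WithLp.toLp 2 (ρ₁.op s h v.fst, ρ₂.op s h v.snd)
      map_add' := fun v w => by apply pair_ext <;> simp
      map_smul' := fun c v => by apply pair_ext <;> simp [LinearIsometry.map_smulₛₗ]
      norm_map' := fun v => by
        rw [← sq_eq_sq₀ (norm_nonneg _) (norm_nonneg _), WithLp.prod_norm_sq_eq_of_L2,
          WithLp.prod_norm_sq_eq_of_L2]
        simp }
  op_sq s h v := by apply pair_ext <;> simp [ρ₁.op_sq, ρ₂.op_sq]
  eta_tau h₁ h₂ h₃ v := by apply pair_ext <;> simp [ρ₁.eta_tau h₁ h₂ h₃, ρ₂.eta_tau h₁ h₂ h₃]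
  tau_eta h₁ h₂ h₃ v := by apply pair_ext <;> simp [ρ₁.tau_eta h₁ h₂ h₃, ρ₂.tau_eta h₁ h₂ h₃]

theorem SymRep.sum_op (ρ₁ : SymRep S V₁) (ρ₂ : SymRep S V₂) (s : Sym) (h : (S.sq s).isSome)
    (v : WithLp 2 (V₁ × V₂)) :
    (ρ₁.sum ρ₂).op s h v = WithLp.toLp 2 (ρ₁.op s h v.fst, ρ₂.op s h v.snd) := rfl

/-- The zero-dimensional representation. -/
def SymRep.zero (S : SymType) (V : Type u) [NormedAddCommGroup V] [InnerProductSpace ℂ V]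
    [Subsingleton V] : SymRep S V where
  op _ _ :=
    { toFun := fun v => v
      map_add' := fun _ _ => rfl
      map_smul' := fun _ _ => Subsingleton.elim _ _
      norm_map' := fun _ => rfl }
  op_sq _ _ _ := Subsingleton.elim _ _
  eta_tau _ _ _ _ := Subsingleton.elim _ _
  tau_eta _ _ _ _ := Subsingleton.elim _ _

/-- The representation `(η, -τ, -γ)`, which is inverse to `(η, τ, γ)` up to balanced ones. -/
def SymRep.flip (ρ : SymRep S V) : SymRep S V where
  op s h :=
    match s, h with
    | .eta, h => ρ.op .eta h
    | .tau, h => (LinearIsometryEquiv.neg ℂ).toLinearIsometry.comp (ρ.op .tau h)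
    | .chi, h => (LinearIsometryEquiv.neg ℂ).toLinearIsometry.comp (ρ.op .chi h)
  op_sq s h v := by
    cases s
    · exact ρ.op_sq .eta h v
    · simp [ρ.op_sq .tau h v]
    · simp [ρ.op_sq .chi h v]
  eta_tau h₁ h₂ h₃ v := by simp [ρ.eta_tau h₁ h₂ h₃]
  tau_eta h₁ h₂ h₃ v := by simp [ρ.tau_eta h₁ h₂ h₃]

theorem SymRep.UEquiv.refl (ρ : SymRep S V) : ρ.UEquiv ρ :=
  ⟨LinearIsometryEquiv.refl ℂ V, fun _ _ _ => rfl⟩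

theorem SymRep.UEquiv.symm {ρ₁ : SymRep S V₁} {ρ₂ : SymRep S V₂} (h : ρ₁.UEquiv ρ₂) :
    ρ₂.UEquiv ρ₁ := by
  obtain ⟨U, hU⟩ := h
  refine ⟨U.symm, fun s h v => ?_⟩
  apply U.injective
  rw [hU, U.apply_symm_apply, U.apply_symm_apply]

theorem SymRep.UEquiv.trans {ρ₁ : SymRep S V₁} {ρ₂ : SymRep S V₂} {ρ₃ : SymRep S V₃}
    (h : ρ₁.UEquiv ρ₂) (h' : ρ₂.UEquiv ρ₃) : ρ₁.UEquiv ρ₃ := by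
  obtain ⟨U, hU⟩ := h
  obtain ⟨U', hU'⟩ := h'
  exact ⟨U.trans U', fun s h v => by simp [hU, hU']⟩

theorem SymRep.UEquiv.sum {ρ₁ : SymRep S V₁} {ρ₂ : SymRep S V₂} {ρ₃ : SymRep S V₃}
    {ρ₄ : SymRep S V₄} (h : ρ₁.UEquiv ρ₃) (h' : ρ₂.UEquiv ρ₄) :
    (ρ₁.sum ρ₂).UEquiv (ρ₃.sum ρ₄) := by
  obtain ⟨U, hU⟩ := h
  obtain ⟨U', hU'⟩ := h'
  refine ⟨U.withLpProdCongr 2 U', fun s h v => ?_⟩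
  apply pair_ext
  · exact hU s h v.fst
  · exact hU' s h v.snd

theorem SymRep.UEquiv.comm (ρ₁ : SymRep S V₁) (ρ₂ : SymRep S V₂) :
    (ρ₁.sum ρ₂).UEquiv (ρ₂.sum ρ₁) :=
  ⟨LinearIsometryEquiv.withLpProdComm 2 ℂ V₁ V₂, fun _ _ _ => rfl⟩

theorem SymRep.UEquiv.assoc (ρ₁ : SymRep S V₁) (ρ₂ : SymRep S V₂) (ρ₃ : SymRep S V₃) :
    ((ρ₁.sum ρ₂).sum ρ₃).UEquiv (ρ₁.sum (ρ₂.sum ρ₃)) :=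
  ⟨LinearIsometryEquiv.withLpProdAssoc 2 ℂ V₁ V₂ V₃, fun _ _ _ => rfl⟩

theorem SymRep.UEquiv.zero_sum [Subsingleton V₁] (ρ₁ : SymRep S V₁) (ρ₂ : SymRep S V₂) :
    (ρ₁.sum ρ₂).UEquiv ρ₂ :=
  letI : Unique V₁ := { default := 0, uniq := fun _ => Subsingleton.elim _ _ }
  ⟨LinearIsometryEquiv.withLpUniqueProd 2 ℂ V₁ V₂, fun _ _ _ => rfl⟩

theorem SymRep.UEquiv.right_comm (ρ₁ : SymRep S V₁) (ρ₂ : SymRep S V₂) (ρ₃ : SymRep S V₃) :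
    ((ρ₁.sum ρ₂).sum ρ₃).UEquiv ((ρ₁.sum ρ₃).sum ρ₂) :=
  (UEquiv.assoc ρ₁ ρ₂ ρ₃).trans
    (((UEquiv.refl ρ₁).sum (UEquiv.comm ρ₂ ρ₃)).trans (UEquiv.assoc ρ₁ ρ₃ ρ₂).symm)

theorem SymRep.UEquiv.sum_sum_comm (ρ₁ : SymRep S V₁) (ρ₂ : SymRep S V₂) (ρ₃ : SymRep S V₃)
    (ρ₄ : SymRep S V₄) :
    ((ρ₁.sum ρ₂).sum (ρ₃.sum ρ₄)).UEquiv ((ρ₁.sum ρ₃).sum (ρ₂.sum ρ₄)) :=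
  (UEquiv.assoc (ρ₁.sum ρ₂) ρ₃ ρ₄).symm.trans
    (((UEquiv.right_comm ρ₁ ρ₂ ρ₃).sum (UEquiv.refl ρ₄)).trans
      (UEquiv.assoc (ρ₁.sum ρ₃) ρ₂ ρ₄))

theorem SymRep.IsBalanced.sum {ρ₁ : SymRep S V₁} {ρ₂ : SymRep S V₂} (h₁ : ρ₁.IsBalanced)
    (h₂ : ρ₂.IsBalanced) : (ρ₁.sum ρ₂).IsBalanced := by
  obtain ⟨U, ⟨he, ht, hc⟩, hp, hm⟩ := h₁
  obtain ⟨U', ⟨he', ht', hc'⟩, hp', hm'⟩ := h₂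
  refine ⟨U.withLpProdCongr 2 U', ⟨fun h v => ?_, fun h v => ?_, fun h v => ?_⟩,
    fun v hv => ?_, fun v hv => ?_⟩
  · apply pair_ext
    · exact he h v.fst
    · exact he' h v.snd
  · apply pair_ext
    · exact ht h v.fst
    · exact ht' h v.snd
  · apply pair_ext
    · exact hc h v.fst
    · exact hc' h v.snd
  · apply pair_ext
    · exact hp _ (congrArg WithLp.fst hv)
    · exact hp' _ (congrArg WithLp.snd hv)
  · apply pair_ext
    · exact hm _ (congrArg WithLp.fst hv)
    · exact hm' _ (congrArg WithLp.snd hv)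

theorem SymRep.isBalanced_of_subsingleton [Subsingleton V] (ρ : SymRep S V) : ρ.IsBalanced :=
  ⟨LinearIsometryEquiv.refl ℂ V,
    ⟨fun _ _ => Subsingleton.elim _ _, fun _ _ => Subsingleton.elim _ _,
      fun _ _ => Subsingleton.elim _ _⟩,
    fun _ _ => Subsingleton.elim _ _, fun _ _ => Subsingleton.elim _ _⟩

theorem SymRep.flip_eta (ρ : SymRep S V) (h : (S.sq .eta).isSome) (v : V) :
    ρ.flip.op .eta h v = ρ.op .eta h v := rfl

theorem SymRep.flip_tau (ρ : SymRep S V) (h : (S.sq .tau).isSome) (v : V) :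
    ρ.flip.op .tau h v = -ρ.op .tau h v := rfl

theorem SymRep.flip_chi (ρ : SymRep S V) (h : (S.sq .chi).isSome) (v : V) :
    ρ.flip.op .chi h v = -ρ.op .chi h v := rfl

theorem SymRep.isBalanced_sum_flip (ρ : SymRep S V) : (ρ.sum ρ.flip).IsBalanced := by
  refine ⟨(LinearIsometryEquiv.withLpProdComm 2 ℂ V V).trans
    ((LinearIsometryEquiv.refl ℂ V).withLpProdCongr 2 (LinearIsometryEquiv.neg ℂ)),
    ⟨fun h v => ?_, fun h v => ?_, fun h v => ?_⟩, fun v hv => ?_, fun v hv => ?_⟩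
  · apply pair_ext
    · rfl
    · exact (ρ.op .eta h).map_neg v.fst
  · apply pair_ext
    · exact (neg_neg _).symm
    · change -ρ.op .tau h (-v.fst) = ρ.op .tau h v.fst
      rw [map_neg, neg_neg]
  · apply pair_ext
    · exact (neg_neg _).symm
    · change -ρ.op .chi h (-v.fst) = ρ.op .chi h v.fst
      rw [map_neg, neg_neg]
  · have h1 : v.snd = v.fst := congrArg WithLp.fst hv
    have h2 : -v.fst = v.snd := congrArg WithLp.snd hv
    have h3 : v.fst = 0 := eq_zero_of_eq_neg (h1.symm.trans h2.symm)
    exact pair_ext h3 (h1.trans h3)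
  · have h1 : v.snd = -v.fst := congrArg WithLp.fst hv
    have h2 : -v.fst = -v.snd := congrArg WithLp.snd hv
    have h3 : v.snd = 0 := eq_zero_of_eq_neg (h1.trans h2)
    exact pair_ext ((neg_injective h2).trans h3) h3

theorem SymRep.IsBalanced.flip {ρ : SymRep S V} (h : ρ.IsBalanced) : ρ.flip.IsBalanced := by
  obtain ⟨U, ⟨he, ht, hc⟩, hp, hm⟩ := h
  refine ⟨U, ⟨he, fun h v => ?_, fun h v => ?_⟩, hp, hm⟩
  · rw [ρ.flip_tau, ρ.flip_tau, ht, map_neg]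
  · rw [ρ.flip_chi, ρ.flip_chi, hc, map_neg]

theorem SymRep.UEquiv.flip {ρ₁ : SymRep S V₁} {ρ₂ : SymRep S V₂} (h : ρ₁.UEquiv ρ₂) :
    ρ₁.flip.UEquiv ρ₂.flip := by
  obtain ⟨U, hU⟩ := h
  refine ⟨U, fun s h v => ?_⟩
  cases s
  · exact hU .eta h v
  · rw [ρ₁.flip_tau, ρ₂.flip_tau, map_neg, hU]
  · rw [ρ₁.flip_chi, ρ₂.flip_chi, map_neg, hU]

theorem SymRep.UEquiv.flip_sum (ρ₁ : SymRep S V₁) (ρ₂ : SymRep S V₂) :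
    (ρ₁.sum ρ₂).flip.UEquiv (ρ₁.flip.sum ρ₂.flip) :=
  ⟨LinearIsometryEquiv.refl ℂ _, fun s _ _ => by cases s <;> rfl⟩

theorem SymRep.inner_op_re (ρ : SymRep S V) (s : Sym) (h : (S.sq s).isSome) (v w : V) :
    (inner ℂ (ρ.op s h v) (ρ.op s h w)).re = (inner ℂ v w).re := by
  have h1 := norm_add_sq (𝕜 := ℂ) (ρ.op s h v) (ρ.op s h w)
  have h2 := norm_add_sq (𝕜 := ℂ) v w
  rw [← map_add, LinearIsometry.norm_map, LinearIsometry.norm_map, LinearIsometry.norm_map] at h1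
  simp only [RCLike.re_to_complex] at h1 h2
  linarith

theorem SymRep.op_surjective (ρ : SymRep S V) (s : Sym) (h : (S.sq s).isSome) :
    Function.Surjective (ρ.op s h) := by
  intro v
  have hs : ((S.sq s).get h) * ((S.sq s).get h) = 1 := by
    cases S <;> cases s <;> first | rfl | simp [SymType.sq] at h
  refine ⟨(S.sq s).get h • ρ.op s h v, ?_⟩
  rw [map_zsmul, ρ.op_sq, smul_smul, hs, one_smul]

end Rep

/-! ### The index group -/

/-- A finite-dimensional representation of the symmetry type `S`. -/
structure FinRep (S : SymType) : Type (u + 1) where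
  space : Type u
  [normed : NormedAddCommGroup space]
  [inner : InnerProductSpace ℂ space]
  [finite : FiniteDimensional ℂ space]
  rep : SymRep S space

attribute [instance] FinRep.normed FinRep.inner FinRep.finite

/-- The direct sum of finite-dimensional representations. -/
def FinRep.sum {S : SymType} (a b : FinRep.{u} S) : FinRep.{u} S where
  space := WithLp 2 (a.space × b.space)
  rep := a.rep.sum b.rep

/-- Two representations are equivalent if they become unitarily equivalent after adding suitable
balanced representations. -/
def FinRep.Stable {S : SymType} (a b : FinRep.{u} S) : Prop :=
  ∃ β₁ β₂ : FinRep.{u} S, β₁.rep.IsBalanced ∧ β₂.rep.IsBalanced ∧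
    (a.sum β₁).rep.UEquiv (b.sum β₂).rep

/-- The zero-dimensional representation. -/
def FinRep.zero (S : SymType) : FinRep.{u} S where
  space := EuclideanSpace ℂ PEmpty.{u + 1}
  rep := SymRep.zero S _

instance FinRep.zero_subsingleton (S : SymType) : Subsingleton (FinRep.zero.{u} S).space :=
  inferInstanceAs (Subsingleton (EuclideanSpace ℂ PEmpty.{u + 1}))

theorem FinRep.Stable.of_uEquiv {S : SymType} {a b : FinRep.{u} S} (h : a.rep.UEquiv b.rep) :
    a.Stable b :=
  ⟨FinRep.zero S, FinRep.zero S, SymRep.isBalanced_of_subsingleton (FinRep.zero S).rep,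
    SymRep.isBalanced_of_subsingleton (FinRep.zero S).rep, h.sum (SymRep.UEquiv.refl _)⟩

theorem FinRep.Stable.symm {S : SymType} {a b : FinRep.{u} S} (h : a.Stable b) : b.Stable a := by
  obtain ⟨β₁, β₂, h₁, h₂, h⟩ := h
  exact ⟨β₂, β₁, h₂, h₁, h.symm⟩

theorem FinRep.Stable.trans {S : SymType} {a b c : FinRep.{u} S} (h : a.Stable b)
    (h' : b.Stable c) : a.Stable c := by
  obtain ⟨β₁, β₂, h₁, h₂, h⟩ := h
  obtain ⟨β₃, β₄, h₃, h₄, h'⟩ := h'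
  refine ⟨β₁.sum β₃, β₄.sum β₂, h₁.sum h₃, h₄.sum h₂, ?_⟩
  exact (SymRep.UEquiv.assoc a.rep β₁.rep β₃.rep).symm.trans
    ((h.sum (SymRep.UEquiv.refl β₃.rep)).trans
      ((SymRep.UEquiv.right_comm b.rep β₂.rep β₃.rep).trans
        ((h'.sum (SymRep.UEquiv.refl β₂.rep)).trans
          (SymRep.UEquiv.assoc c.rep β₄.rep β₂.rep))))

theorem FinRep.Stable.sum {S : SymType} {a b a' b' : FinRep.{u} S} (h : a.Stable a')
    (h' : b.Stable b') : (a.sum b).Stable (a'.sum b') := by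
  obtain ⟨β₁, β₂, h₁, h₂, h⟩ := h
  obtain ⟨β₃, β₄, h₃, h₄, h'⟩ := h'
  refine ⟨β₁.sum β₃, β₂.sum β₄, h₁.sum h₃, h₂.sum h₄, ?_⟩
  exact (SymRep.UEquiv.sum_sum_comm a.rep b.rep β₁.rep β₃.rep).trans
    ((h.sum h').trans (SymRep.UEquiv.sum_sum_comm a'.rep b'.rep β₂.rep β₄.rep).symm)

/-- The representation `(η, -τ, -γ)`. -/
def FinRep.flip {S : SymType} (a : FinRep.{u} S) : FinRep.{u} S where
  space := a.space
  rep := a.rep.flip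

theorem FinRep.Stable.flip {S : SymType} {a b : FinRep.{u} S} (h : a.Stable b) :
    a.flip.Stable b.flip := by
  obtain ⟨β₁, β₂, h₁, h₂, h⟩ := h
  exact ⟨β₁.flip, β₂.flip, h₁.flip, h₂.flip, (SymRep.UEquiv.flip_sum a.rep β₁.rep).symm.trans
    (h.flip.trans (SymRep.UEquiv.flip_sum b.rep β₂.rep))⟩

theorem FinRep.stable_zero {S : SymType} {a : FinRep.{u} S} (h : a.rep.IsBalanced) :
    a.Stable (FinRep.zero S) :=
  ⟨FinRep.zero S, a, SymRep.isBalanced_of_subsingleton (FinRep.zero S).rep, h,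
    SymRep.UEquiv.comm _ _⟩

/-- Finite-dimensional representations up to stable equivalence. -/
def FinRep.setoid (S : SymType) : Setoid (FinRep.{u} S) where
  r := FinRep.Stable
  iseqv :=
    { refl := fun _ => FinRep.Stable.of_uEquiv (SymRep.UEquiv.refl _)
      symm := FinRep.Stable.symm
      trans := FinRep.Stable.trans }

/-- The index group of the symmetry type `S`: the equivalence classes of finite-dimensional
representations modulo balanced ones. -/
def IndexGroup (S : SymType) : Type (u + 1) := Quotient (FinRep.setoid.{u} S)

/-- The class of a finite-dimensional representation in the index group. -/
def FinRep.cls {S : SymType} (a : FinRep.{u} S) : IndexGroup.{u} S :=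
  Quotient.mk (FinRep.setoid S) a

theorem FinRep.cls_eq {S : SymType} {a b : FinRep.{u} S} (h : a.Stable b) : a.cls = b.cls :=
  Quotient.sound (s := FinRep.setoid S) h

instance IndexGroup.instZero (S : SymType) : Zero (IndexGroup.{u} S) := ⟨(FinRep.zero S).cls⟩

instance IndexGroup.instAdd (S : SymType) : Add (IndexGroup.{u} S) :=
  ⟨Quotient.map₂ FinRep.sum (fun _ _ h _ _ h' => FinRep.Stable.sum h h')⟩

instance IndexGroup.instNeg (S : SymType) : Neg (IndexGroup.{u} S) :=
  ⟨Quotient.map FinRep.flip (fun _ _ h => FinRep.Stable.flip h)⟩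

/-- The index group is an abelian group, with the direct sum as addition and the class of
`(η, -τ, -γ)` as inverse of the class of `(η, τ, γ)`. -/
instance IndexGroup.instAddCommGroup (S : SymType) : AddCommGroup (IndexGroup.{u} S) where
  add_assoc := by
    rintro ⟨a⟩ ⟨b⟩ ⟨c⟩
    exact FinRep.cls_eq (.of_uEquiv (SymRep.UEquiv.assoc a.rep b.rep c.rep))
  zero_add := by
    rintro ⟨a⟩
    exact FinRep.cls_eq (.of_uEquiv (SymRep.UEquiv.zero_sum (FinRep.zero S).rep a.rep))
  add_zero := by
    rintro ⟨a⟩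
    exact FinRep.cls_eq (.of_uEquiv ((SymRep.UEquiv.comm _ _).trans
      (SymRep.UEquiv.zero_sum (FinRep.zero S).rep a.rep)))
  add_comm := by
    rintro ⟨a⟩ ⟨b⟩
    exact FinRep.cls_eq (.of_uEquiv (SymRep.UEquiv.comm a.rep b.rep))
  neg_add_cancel := by
    rintro ⟨a⟩
    exact FinRep.cls_eq ((FinRep.Stable.of_uEquiv (SymRep.UEquiv.comm a.rep.flip a.rep)).trans
      (FinRep.stable_zero (a := a.sum a.flip) a.rep.isBalanced_sum_flip))
  nsmul := nsmulRec
  zsmul := zsmulRec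

theorem FinRep.cls_sum {S : SymType} (a b : FinRep.{u} S) : (a.sum b).cls = a.cls + b.cls := rfl

theorem FinRep.cls_eq_zero {S : SymType} {a : FinRep.{u} S} (h : a.rep.IsBalanced) :
    a.cls = 0 :=
  FinRep.cls_eq (FinRep.stable_zero h)

/-! ### Admissible essentially unitary operators and their symmetry index -/

section Operators

open ContinuousLinearMap (adjoint)

variable {S : SymType} {V : Type u} [NormedAddCommGroup V] [InnerProductSpace ℂ V]
  [CompleteSpace V]

/-- `W` is an admissible essentially unitary operator for the representation `ρ`: it is unitary up
to compact operators, satisfies the symmetry relations exactly, and has essential gaps at `1` and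
`-1`, i.e. `W - 1` and `W + 1` are invertible up to compact operators. -/
structure IsAdmissible (ρ : SymRep S V) (W : V →L[ℂ] V) : Prop where
  compact_left : IsCompactOperator (adjoint W * W - 1 : V →L[ℂ] V)
  compact_right : IsCompactOperator (W * adjoint W - 1 : V →L[ℂ] V)
  symmetric : ρ.Intertwines W (adjoint W)
  gap_one : ∃ R : V →L[ℂ] V, IsCompactOperator (R * (W - 1) - 1 : V →L[ℂ] V)
  gap_neg_one : ∃ R : V →L[ℂ] V, IsCompactOperator (R * (W + 1) - 1 : V →L[ℂ] V)

/-- The imaginary part `(W - W*) / (2 i)`. -/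
def imPart (W : V →L[ℂ] V) : V →L[ℂ] V := (1 / (2 * Complex.I)) • (W - adjoint W)

/-- The `0`-eigenspace of the imaginary part of `W`. -/
def imKer (W : V →L[ℂ] V) : Submodule ℂ V := LinearMap.ker (imPart W).toLinearMap

theorem mem_imKer {W : V →L[ℂ] V} {v : V} : v ∈ imKer W ↔ W v = adjoint W v := by
  simp [imKer, imPart, sub_eq_zero]

theorem SymRep.Intertwines.adjoint {ρ : SymRep S V} {W : V →L[ℂ] V}
    (hW : ρ.Intertwines W (adjoint W)) : ρ.Intertwines (adjoint W) W := by
  have key : ∀ (s : Sym) (h : (S.sq s).isSome) (A B : V →L[ℂ] V),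
      (∀ v, ρ.op s h (A v) = B (ρ.op s h v)) →
      ∀ v, ρ.op s h (ContinuousLinearMap.adjoint A v)
        = ContinuousLinearMap.adjoint B (ρ.op s h v) := by
    intro s h A B hAB v
    rw [← sub_eq_zero, ← inner_self_eq_zero (𝕜 := ℂ)]
    have hre : ∀ w, (inner ℂ (ρ.op s h (ContinuousLinearMap.adjoint A v)
        - ContinuousLinearMap.adjoint B (ρ.op s h v)) w).re = 0 := by
      intro w
      obtain ⟨u, rfl⟩ := ρ.op_surjective s h w
      rw [inner_sub_left, Complex.sub_re, ρ.inner_op_re, ContinuousLinearMap.adjoint_inner_left,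
        ContinuousLinearMap.adjoint_inner_left, ← hAB, ρ.inner_op_re, sub_self]
    apply Complex.ext
    · exact hre _
    · exact inner_self_im (𝕜 := ℂ) _
  refine ⟨fun h v => key .eta h W W (hW.1 h) v, fun h v => ?_, fun h v => ?_⟩
  · rw [key .tau h W _ (hW.2.1 h) v, ContinuousLinearMap.adjoint_adjoint]
  · rw [key .chi h W _ (hW.2.2 h) v, ContinuousLinearMap.adjoint_adjoint]

theorem IsAdmissible.leaves_imKer {ρ : SymRep S V} {W : V →L[ℂ] V} (hW : IsAdmissible ρ W) :
    ρ.Leaves (imKer W) := by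
  intro s h v hv
  rw [mem_imKer] at hv ⊢
  have h1 := hW.symmetric
  have h2 := hW.symmetric.adjoint
  cases s
  · rw [← h1.1, ← h2.1, hv]
  · rw [← h1.2.1, ← h2.2.1, hv]
  · rw [← h1.2.2, ← h2.2.2, hv]

theorem IsAdmissible.finite_imKer {ρ : SymRep S V} {W : V →L[ℂ] V} (hW : IsAdmissible ρ W) :
    FiniteDimensional ℂ (imKer W) := by
  obtain ⟨R₁, h₁⟩ := hW.gap_one
  obtain ⟨R₂, h₂⟩ := hW.gap_neg_one
  set K : V →L[ℂ] V := W * adjoint W - 1 with hK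
  set K₁ : V →L[ℂ] V := R₁ * (W - 1) - 1 with hK₁
  set K₂ : V →L[ℂ] V := R₂ * (W + 1) - 1 with hK₂
  set C : V →L[ℂ] V := R₂ * (R₁ * K - K₁ * (W + 1)) - K₂ with hC
  have hCc : IsCompactOperator C := by
    refine IsCompactOperator.sub ?_ h₂
    refine IsCompactOperator.clm_comp (f := ⇑(R₁ * K - K₁ * (W + 1))) ?_ R₂
    exact IsCompactOperator.sub (hW.compact_right.clm_comp R₁) (h₁.comp_clm (W + 1))
  have hfix : ∀ v ∈ imKer W, C v = v := by
    intro v hv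
    rw [mem_imKer] at hv
    have e : K v = W (W v) - v := by simp [hK, hv]
    simp only [hC, hK₁, hK₂, sub_apply, mul_apply_eq_comp,
      add_apply, one_apply_eq_self, e, map_sub, map_add]
    abel
  have hclosed : IsClosed (imKer W : Set V) := ContinuousLinearMap.isClosed_ker (imPart W)
  refine FiniteDimensional.of_isCompactOperator_id (𝕜 := ℂ) ?_
  have hres : IsCompactOperator fun v : imKer W => C v := hCc.comp_clm (imKer W).subtypeL
  have hmem : ∀ v : imKer W, C v ∈ imKer W := fun v => by rw [hfix v v.2]; exact v.2
  have hid : (id : imKer W → imKer W) = Set.codRestrict (fun v : imKer W => C v) (imKer W) hmem :=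
    funext fun v => Subtype.ext (hfix v v.2).symm
  rw [hid]
  exact hres.codRestrict hmem hclosed

/-- The symmetry representation on the `0`-eigenspace of `Im W`. -/
def IsAdmissible.kerRep {ρ : SymRep S V} {W : V →L[ℂ] V} (hW : IsAdmissible ρ W) :
    FinRep.{u} S :=
  haveI := hW.finite_imKer
  { space := imKer W
    rep := ρ.restrict (imKer W) hW.leaves_imKer }

open Classical in
/-- The symmetry index `si(W)` of an admissible essentially unitary operator `W`: the class in the
index group of the symmetry representation on the `0`-eigenspace of `Im W`. (The value for operators
which are not admissible is irrelevant.) -/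
def si (ρ : SymRep S V) (W : V →L[ℂ] V) : IndexGroup.{u} S :=
  if hW : IsAdmissible ρ W then hW.kerRep.cls else 0

/-- The operator `P W P`, considered as an operator on the range `K` of the orthogonal
projection `P`. -/
def compress (K : Submodule ℂ V) [K.HasOrthogonalProjection] (W : V →L[ℂ] V) : K →L[ℂ] K :=
  K.orthogonalProjectionOnto ∘L W ∘L K.subtypeL

end Operators

/-! ### Lattice systems and walks -/

/-- A one-dimensional lattice system of symmetry type `S` on the Hilbert space `H`: a decomposition
of `H` as the Hilbert space direct sum of cells `H_x`, `x ∈ ℤ`, of finite non-vanishing dimension,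
with a symmetry representation that acts locally and is balanced in every cell. -/
structure LatticeSystem (S : SymType) (H : Type u) [NormedAddCommGroup H]
    [InnerProductSpace ℂ H] where
  cell : ℤ → Submodule ℂ H
  finite : ∀ x, FiniteDimensional ℂ (cell x)
  nontrivial : ∀ x, Nontrivial (cell x)
  orthogonal : OrthogonalFamily ℂ (fun x => cell x) (fun x => (cell x).subtypeₗᵢ)
  dense : (⨆ x, cell x).topologicalClosure = ⊤
  rep : SymRep S H
  leaves_cell : ∀ x, rep.Leaves (cell x)
  balanced : ∀ x, (rep.restrict (cell x) (leaves_cell x)).IsBalanced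

namespace LatticeSystem

variable {S : SymType} {H : Type u} [NormedAddCommGroup H] [InnerProductSpace ℂ H]
  (L : LatticeSystem S H)

/-- The closed subspace `⨁_{x ∈ I} H_x`. -/
def cellSpan (I : Set ℤ) : Submodule ℂ H := (⨆ x ∈ I, L.cell x).topologicalClosure

theorem leaves_cellSpan (I : Set ℤ) : L.rep.Leaves (L.cellSpan I) := by
  intro s h v hv
  have hle : (⨆ x ∈ I, L.cell x) ≤
      (⨆ x ∈ I, L.cell x).comap (L.rep.op s h).toLinearMap := by
    refine iSup₂_le fun x hx v hv => ?_
    exact (le_iSup₂_of_le (f := fun x (_ : x ∈ I) => L.cell x) x hx le_rfl)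
      (L.leaves_cell x s h v hv)
  exact map_mem_closure (L.rep.op s h).continuous hv fun w hw => hle hw

variable [CompleteSpace H]

instance instCompleteSpaceCellSpan (I : Set ℤ) : CompleteSpace (L.cellSpan I) :=
  inferInstanceAs (CompleteSpace (⨆ x ∈ I, L.cell x).topologicalClosure)

/-- The half-space `⨁_{x < a} H_x`, the range of `P_{<a}`. -/
abbrev lt (a : ℤ) : Submodule ℂ H := L.cellSpan (Set.Iio a)

/-- The half-space `⨁_{x ≥ a} H_x`, the range of `P_{≥a}`. -/
abbrev ge (a : ℤ) : Submodule ℂ H := L.cellSpan (Set.Ici a)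

/-- The symmetry representation on the left half-space. -/
def repLt (a : ℤ) : SymRep S (L.lt a) := L.rep.restrict (L.lt a) (L.leaves_cellSpan _)

/-- The symmetry representation on the right half-space. -/
def repGe (a : ℤ) : SymRep S (L.ge a) := L.rep.restrict (L.ge a) (L.leaves_cellSpan _)

/-- `W` is essentially local: `P_{≥a} W P_{<a}` and `P_{<a} W P_{≥a}` are compact for some `a`. -/
def IsEssLocal (W : H →L[ℂ] H) : Prop :=
  ∃ a : ℤ, IsCompactOperator ((L.ge a).starProjection * W * (L.lt a).starProjection) ∧
    IsCompactOperator ((L.lt a).starProjection * W * (L.ge a).starProjection)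

/-- `W` is an essentially unitary walk: an admissible essentially unitary operator which is
essentially local. -/
def IsWalk (W : H →L[ℂ] H) : Prop := IsAdmissible L.rep W ∧ L.IsEssLocal W

/-- The left symmetry index `si(P_{<a} W P_{<a})`. -/
def siLeft (a : ℤ) (W : H →L[ℂ] H) : IndexGroup.{u} S := si (L.repLt a) (compress (L.lt a) W)

/-- The right symmetry index `si(P_{≥a} W P_{≥a})`. -/
def siRight (a : ℤ) (W : H →L[ℂ] H) : IndexGroup.{u} S := si (L.repGe a) (compress (L.ge a) W)

/-- `W₂` is a gentle perturbation of `W₁`: they are connected by a norm-continuous path of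
essentially unitary walks. -/
def IsGentlePerturbation (W₁ W₂ : H →L[ℂ] H) : Prop :=
  ∃ w : C(unitInterval, H →L[ℂ] H), w 0 = W₁ ∧ w 1 = W₂ ∧ ∀ t, L.IsWalk (w t)

/-- `W₂` is a compact perturbation of `W₁` (as walks). -/
def IsCompactPerturbation (W₁ W₂ : H →L[ℂ] H) : Prop :=
  L.IsWalk W₁ ∧ L.IsWalk W₂ ∧ IsCompactOperator (W₂ - W₁)

/-- `W₂` is a local perturbation of `W₁` (as walks): `W₂ - W₁` is non-zero only on finitely many
cells. -/
def IsLocalPerturbation (W₁ W₂ : H →L[ℂ] H) : Prop :=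
  L.IsWalk W₁ ∧ L.IsWalk W₂ ∧ {x : ℤ | ∃ v ∈ L.cell x, (W₂ - W₁) v ≠ 0}.Finite

/-- The decoupled operator `W_L ⊕ W_R` on `H = P_{<a} H ⊕ P_{≥a} H`. -/
def directSum (a : ℤ) (WL : L.lt a →L[ℂ] L.lt a) (WR : L.ge a →L[ℂ] L.ge a) : H →L[ℂ] H :=
  (L.lt a).subtypeL ∘L WL ∘L (L.lt a).orthogonalProjectionOnto +
    (L.ge a).subtypeL ∘L WR ∘L (L.ge a).orthogonalProjectionOnto

/-- `W` is translation invariant with respect to a unitary shift `T` which maps each cell onto the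
next one and commutes with the symmetries. -/
def IsTranslationInvariant (W : H →L[ℂ] H) : Prop :=
  ∃ T : H ≃ₗᵢ[ℂ] H, (∀ x, (L.cell x).map T.toLinearEquiv.toLinearMap = L.cell (x + 1)) ∧
    (∀ s h v, L.rep.op s h (T v) = T (L.rep.op s h v)) ∧ ∀ v, W (T v) = T (W v)

end LatticeSystem

end

end SymWalk

namespace SymWalk

noncomputable section

universe u

open Polynomial

/-! The index only sees the kernel of A = W - W*, a skew-adjoint operator that commutes with η and
anticommutes with τ and γ. Since W* inverts W up to compacts, W A agrees with (W - 1)(W + 1) up to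
compacts, so the two essential gaps make A invertible up to compacts: its kernel N is
finite-dimensional and A is invertible on the complement of N.

Stability comes from a Schur complement. For W close to W₀, the compression of W - W* to the
complement of N = ker(W₀ - W₀*) stays invertible. Eliminating that complement identifies ker(W - W*)
with the kernel of a skew-adjoint operator s on N obeying the same relations
(`SymRep.cls_ker_eq_of_isUnit_compress`). Where s is invertible, its polar part U is unitary,
satisfies the symmetries and has U² = -1, so that this part of N is balanced
(`SymRep.IsBalanced.of_skew`). Hence the index is locally constant, and constant along
norm-continuous paths (`si_eq_of_path`). Two admissible operators with compact difference are joined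
by a segment of admissible operators (`IsAdmissible.si_eq_of_compact`).

Compression to a half-space is multiplicative up to products of off-diagonal blocks, which essential
locality makes compact; so the half-space operators are admissible. Dropping the off-diagonal blocks
is a compact perturbation, and the kernel of a block diagonal operator splits, whence the sum
formula (`SymRep.Splitting.si_eq_add`). Moving the cut by one cell is the same formula with a
finite-dimensional balanced summand. That summand contributes nothing: in finite dimensions every
perturbation is compact, so the operator may be exchanged for a gapped unitary.

For a translation invariant W the shift acts on the finite-dimensional kernel. An eigenvector there
would have overlaps of constant modulus with infinitely many orthogonal translates of a cell vector,
which Bessel's inequality forbids unless the overlaps vanish.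

Throughout, antilinear symmetries have to be respected. Functional calculus therefore uses real
polynomials, and adjoints are handled through real parts of inner products. -/

theorem commute_aeval {R A : Type*} [CommSemiring R] [Semiring A] [Algebra R A] {a b : A}
    (h : Commute a b) (p : R[X]) : Commute a (aeval b p) := by
  induction p using Polynomial.induction_on' with
  | add p q hp hq => rw [map_add]; exact hp.add_right hq
  | monomial n c =>
    rw [aeval_monomial]
    exact Commute.mul_right (Algebra.commutes c a).symm (h.pow_right n)

/-! ### Polar decomposition in finite dimensions -/

theorem aeval_isSymmetric {V : Type u} [NormedAddCommGroup V] [InnerProductSpace ℂ V]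
    {P : V →ₗ[ℂ] V} (hP : P.IsSymmetric) (p : ℝ[X]) :
    (aeval (R := ℝ) (A := Module.End ℂ V) P p).IsSymmetric := by
  induction p using Polynomial.induction_on' with
  | add p q hp hq => rw [map_add]; exact hp.add hq
  | monomial n c =>
    intro v w
    rw [aeval_monomial]
    change inner ℂ (algebraMap ℝ (Module.End ℂ V) c ((P ^ n) v)) w =
      inner ℂ v (algebraMap ℝ (Module.End ℂ V) c ((P ^ n) w))
    rw [Module.algebraMap_end_apply, Module.algebraMap_end_apply, inner_smul_left_eq_smul,
      inner_smul_right_eq_smul, hP.pow n]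

/-- A positive definite operator has an inverse square root among its real polynomials. -/
theorem exists_aeval_sq_mul_eq_one {V : Type u} [NormedAddCommGroup V] [InnerProductSpace ℂ V]
    [FiniteDimensional ℂ V] {P : V →ₗ[ℂ] V} (hP : P.IsSymmetric)
    (hpos : ∀ v ≠ 0, 0 < (inner ℂ (P v) v).re) :
    ∃ p : ℝ[X], ∀ v, P (aeval (R := ℝ) (A := Module.End ℂ V) P p
      (aeval (R := ℝ) (A := Module.End ℂ V) P p v)) = v := by
  set b := hP.eigenvectorBasis rfl with hb
  set l := hP.eigenvalues rfl with hl
  have hPb : ∀ i, P (b i) = (l i : ℂ) • b i := hP.apply_eigenvectorBasis rfl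
  have hlpos : ∀ i, 0 < l i := by
    intro i
    have h := hpos (b i) (b.orthonormal.ne_zero i)
    rw [hPb, inner_smul_left, inner_self_eq_norm_sq_to_K, b.orthonormal.1 i] at h
    simpa using h
  -- Interpolating x ↦ x^(-1/2) on the spectrum keeps the inverse root a real polynomial in P, so it
  -- commutes with everything that commutes with P, antilinear operators included.
  let p : ℝ[X] := Lagrange.interpolate (Finset.univ.image l) id (fun x => (√x)⁻¹)
  have hp : ∀ i, p.eval (l i) = (√(l i))⁻¹ := fun i =>
    Lagrange.eval_interpolate_at_node (v := id) _ Function.injective_id.injOn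
      (Finset.mem_image_of_mem l (Finset.mem_univ i))
  have hpb : ∀ i, aeval (R := ℝ) (A := Module.End ℂ V) P p (b i)
      = ((√(l i))⁻¹ : ℂ) • b i := by
    intro i
    rw [← aeval_map_algebraMap ℂ (P : Module.End ℂ V) p,
      Module.End.aeval_apply_of_hasEigenvector (hP.hasEigenvector_eigenvectorBasis rfl i)]
    congr 1
    change eval ((algebraMap ℝ ℂ) (l i)) _ = _
    rw [eval_map_algebraMap, aeval_algebraMap_apply]
    simp [hp]
  refine ⟨p, fun v => ?_⟩
  refine LinearMap.congr_fun (f := P ∘ₗ (aeval (R := ℝ) (A := Module.End ℂ V) P p) ∘ₗ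
      (aeval (R := ℝ) (A := Module.End ℂ V) P p)) (g := LinearMap.id)
    (b.toBasis.ext fun i => ?_) v
  have h0 : ((√(l i) : ℝ) : ℂ) ≠ 0 := by
    exact_mod_cast (Real.sqrt_pos.2 (hlpos i)).ne'
  have h1 : ((√(l i) : ℝ) : ℂ) * (√(l i) : ℝ) = l i := by
    exact_mod_cast Real.mul_self_sqrt (hlpos i).le
  simp only [OrthonormalBasis.coe_toBasis, LinearMap.comp_apply, LinearMap.id_apply, hpb, map_smul,
    hPb, smul_smul]
  rw [← h1]
  field_simp
  simp

/-- Polar decomposition of an injective operator between spaces of the same finite dimension. -/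
theorem exists_polar {V₁ V₂ : Type u} [NormedAddCommGroup V₁] [InnerProductSpace ℂ V₁]
    [NormedAddCommGroup V₂] [InnerProductSpace ℂ V₂] [FiniteDimensional ℂ V₁]
    (T : V₁ →ₗ[ℂ] V₂) (T' : V₂ →ₗ[ℂ] V₁)
    (hT : ∀ v w, inner ℂ (T v) w = inner ℂ v (T' w)) (hinj : ∀ v, T v = 0 → v = 0)
    (hfin : Module.finrank ℂ V₁ = Module.finrank ℂ V₂) [FiniteDimensional ℂ V₂] :
    ∃ (p : ℝ[X]) (U : V₁ ≃ₗᵢ[ℂ] V₂),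
      ∀ v, U v = T (aeval (R := ℝ) (A := Module.End ℂ V₁) (T' ∘ₗ T) p v) := by
  have hP : (T' ∘ₗ T).IsSymmetric := by
    intro v w
    rw [LinearMap.comp_apply, LinearMap.comp_apply, ← hT, ← inner_conj_symm, ← hT, inner_conj_symm]
  have hpos : ∀ v ≠ 0, 0 < (inner ℂ ((T' ∘ₗ T) v) v).re := by
    intro v hv
    rw [hP, LinearMap.comp_apply, ← hT]
    exact re_inner_self_pos (𝕜 := ℂ).2 fun h => hv (hinj v h)
  obtain ⟨p, hp⟩ := exists_aeval_sq_mul_eq_one hP hpos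
  have hsym := aeval_isSymmetric hP p
  have hcomm : ∀ v, aeval (R := ℝ) (A := Module.End ℂ V₁) (T' ∘ₗ T) p ((T' ∘ₗ T) v) =
      (T' ∘ₗ T) (aeval (R := ℝ) (A := Module.End ℂ V₁) (T' ∘ₗ T) p v) := fun v =>
    LinearMap.congr_fun (commute_aeval (Commute.refl (T' ∘ₗ T : Module.End ℂ V₁)) p).eq.symm v
  set q := aeval (R := ℝ) (A := Module.End ℂ V₁) (T' ∘ₗ T) p with hq
  -- With P = T'T and q = p(P), the product q P q = P q² = 1 says that T q is isometric; equality of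
  -- dimensions makes it onto.
  let J : V₁ →ₗᵢ[ℂ] V₂ := (T ∘ₗ q).isometryOfInner fun v w => by
    rw [LinearMap.comp_apply, LinearMap.comp_apply, hT, hsym]
    change inner ℂ v (q ((T' ∘ₗ T) (q w))) = _
    rw [hcomm, hp]
  exact ⟨p, J.toLinearIsometryEquiv hfin, fun v => rfl⟩

/-! ### Consequences for symmetry representations -/

section

variable {S : SymType} {V V₁ V₂ : Type u} [NormedAddCommGroup V] [InnerProductSpace ℂ V]
  [NormedAddCommGroup V₁] [InnerProductSpace ℂ V₁] [NormedAddCommGroup V₂] [InnerProductSpace ℂ V₂]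

theorem SymRep.op_real_smul (ρ : SymRep S V) (s : Sym) (h : (S.sq s).isSome) (c : ℝ) (v : V) :
    ρ.op s h ((c : ℂ) • v) = (c : ℂ) • ρ.op s h v := by
  rw [LinearIsometry.map_smulₛₗ]
  cases s <;> simp [Sym.twist]

/-- Antilinear operators commute with real scalars only, which is why the coefficients have to be
real. -/
theorem SymRep.op_aeval (ρ : SymRep S V) (s : Sym) (h : (S.sq s).isSome) {P : V →ₗ[ℂ] V}
    (hP : ∀ v, ρ.op s h (P v) = P (ρ.op s h v)) (p : ℝ[X]) (v : V) :
    ρ.op s h (aeval (R := ℝ) (A := Module.End ℂ V) P p v) =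
      aeval (R := ℝ) (A := Module.End ℂ V) P p (ρ.op s h v) := by
  induction p using Polynomial.induction_on generalizing v with
  | C c =>
    rw [aeval_C, Module.algebraMap_end_apply, Module.algebraMap_end_apply]
    exact ρ.op_real_smul s h c v
  | add p q hp hq => simp only [map_add, LinearMap.add_apply, hp, hq]
  | monomial n c ih =>
    rw [pow_succ, ← mul_assoc, map_mul, aeval_X, Module.End.mul_apply, Module.End.mul_apply, ih, hP]

/-- Intertwining relations pass to adjoints. -/
theorem SymRep.intertwines_adjoint (ρ₁ : SymRep S V₁) (ρ₂ : SymRep S V₂) (s : Sym)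
    (h : (S.sq s).isSome) {A A' : V₁ → V₂} {B B' : V₂ → V₁}
    (hA : ∀ v w, inner ℂ (A v) w = inner ℂ v (B w))
    (hA' : ∀ v w, inner ℂ (A' v) w = inner ℂ v (B' w))
    (hop : ∀ v, ρ₂.op s h (A v) = A' (ρ₁.op s h v)) (w : V₂) :
    ρ₁.op s h (B w) = B' (ρ₂.op s h w) := by
  rw [← sub_eq_zero, ← inner_self_eq_zero (𝕜 := ℂ)]
  -- Linear and antilinear isometries alike preserve the real part of the inner product. This is
  -- enough, since the difference is finally paired with itself.
  have hre : ∀ u, (inner ℂ u (ρ₁.op s h (B w) - B' (ρ₂.op s h w))).re = 0 := by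
    intro u
    obtain ⟨u, rfl⟩ := ρ₁.op_surjective s h u
    rw [inner_sub_right, Complex.sub_re, ρ₁.inner_op_re, ← hA, ← hA', ← hop, ρ₂.inner_op_re,
      sub_self]
  exact Complex.ext (hre _) (inner_self_im (𝕜 := ℂ) _)

/-- An equivariant linear isomorphism of finite-dimensional representations can be made unitary. -/
theorem SymRep.UEquiv.of_linear [FiniteDimensional ℂ V₁] [FiniteDimensional ℂ V₂]
    {ρ₁ : SymRep S V₁} {ρ₂ : SymRep S V₂} (T : V₁ ≃ₗ[ℂ] V₂)
    (hT : ∀ s h v, T (ρ₁.op s h v) = ρ₂.op s h (T v)) : ρ₁.UEquiv ρ₂ := by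
  have hadj : ∀ v w, inner ℂ (T.toLinearMap v) w
      = inner ℂ v (LinearMap.adjoint T.toLinearMap w) := fun v w =>
    (LinearMap.adjoint_inner_right _ _ _).symm
  obtain ⟨p, U, hU⟩ := exists_polar T.toLinearMap (LinearMap.adjoint T.toLinearMap) hadj
    (fun v hv => T.map_eq_zero_iff.1 hv) T.finrank_eq
  refine ⟨U, fun s h v => ?_⟩
  have hT' := ρ₁.intertwines_adjoint ρ₂ s h hadj hadj fun v => (hT s h v).symm
  rw [hU, hU, ← ρ₁.op_aeval s h fun v => ?_]
  · exact hT s h _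
  · rw [LinearMap.comp_apply, hT']
    exact congrArg _ (hT s h v).symm

/-- An invertible skew-adjoint operator which satisfies the symmetry relations can be made
unitary. -/
theorem SymRep.IsBalanced.of_skew [FiniteDimensional ℂ V] {ρ : SymRep S V} (s : V →ₗ[ℂ] V)
    (hskew : ∀ v w, inner ℂ (s v) w = -inner ℂ v (s w))
    (hρ : ρ.Intertwines s (-s)) (hinj : ∀ v, s v = 0 → v = 0) : ρ.IsBalanced := by
  obtain ⟨p, U, hU⟩ := exists_polar s (-s)
    (fun v w => by rw [hskew, LinearMap.neg_apply, inner_neg_right]) hinj rfl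
  set P : V →ₗ[ℂ] V := (-s) ∘ₗ s with hP
  have hcomm : ∀ v, s (aeval (R := ℝ) (A := Module.End ℂ V) P p v) =
      aeval (R := ℝ) (A := Module.End ℂ V) P p (s v) := by
    have h : Commute (s : Module.End ℂ V) P := by
      ext v
      simp [hP]
    exact fun v => LinearMap.congr_fun (commute_aeval h p).eq v
  have hPsym : P.IsSymmetric := fun v w => by
    simp [hP, hskew]
  -- U = s p(P) is skew-adjoint, as p(P) is symmetric and commutes with s. Being unitary too, it has
  -- inverse -U, so U² = -1 and neither 1 nor -1 is an eigenvalue.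
  have hsymm : ∀ v, U.symm v = -U v := by
    intro v
    refine ext_inner_left ℂ fun w => ?_
    rw [inner_neg_right, ← U.inner_map_eq_flip, hU, hU, hcomm v, hskew,
      aeval_isSymmetric hPsym]
  -- The sign c is 1 for η and -1 for τ and γ. It cancels in P = -s², so p(P) commutes with every
  -- symmetry and U inherits the sign of s.
  have hop : ∀ (t : Sym) h (c : ℝ), (∀ v, ρ.op t h (s v) = (c : ℂ) • s (ρ.op t h v)) → c * c = 1 →
      ∀ v, ρ.op t h (U v) = (c : ℂ) • U (ρ.op t h v) := by
    intro t h c hs hc v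
    rw [hU, hU, hs, ρ.op_aeval t h fun v => ?_]
    simp only [hP, LinearMap.comp_apply, LinearMap.neg_apply, map_neg, hs, map_smul, smul_smul]
    rw [← Complex.ofReal_mul, hc, Complex.ofReal_one, one_smul]
  refine ⟨U, ⟨fun h v => ?_, fun h v => ?_, fun h v => ?_⟩, fun v hv => ?_, fun v hv => ?_⟩
  · simpa using hop .eta h 1 (by simpa using hρ.1 h) (by norm_num) v
  · simpa [hsymm] using hop .tau h (-1) (by simpa using hρ.2.1 h) (by norm_num) v
  · simpa [hsymm] using hop .chi h (-1) (by simpa using hρ.2.2 h) (by norm_num) v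
  · have h := hsymm v
    rw [hv, U.symm_apply_eq.2 hv.symm] at h
    exact eq_zero_of_eq_neg h
  · have h := hsymm (-v)
    rw [map_neg U, hv, ← hv, U.symm_apply_apply, neg_neg, hv] at h
    exact eq_zero_of_eq_neg h

/-- The representation `ρ` is the orthogonal direct sum of copies of `ρ₁` and `ρ₂`. -/
structure SymRep.Splitting (ρ : SymRep S V) (ρ₁ : SymRep S V₁) (ρ₂ : SymRep S V₂) where
  inl : V₁ →ₗᵢ[ℂ] V
  inr : V₂ →ₗᵢ[ℂ] V
  inl_op : ∀ s h v, inl (ρ₁.op s h v) = ρ.op s h (inl v)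
  inr_op : ∀ s h v, inr (ρ₂.op s h v) = ρ.op s h (inr v)
  inner_inl_inr : ∀ v w, inner ℂ (inl v) (inr w) = 0
  exists_eq : ∀ v, ∃ x y, v = inl x + inr y

theorem SymRep.Splitting.uEquiv {ρ : SymRep S V} {ρ₁ : SymRep S V₁} {ρ₂ : SymRep S V₂}
    (D : ρ.Splitting ρ₁ ρ₂) : (ρ₁.sum ρ₂).UEquiv ρ := by
  let J : WithLp 2 (V₁ × V₂) →ₗᵢ[ℂ] V :=
    { toFun := fun v => D.inl v.fst + D.inr v.snd
      map_add' := fun v w => by simp; abel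
      map_smul' := fun c v => by simp
      norm_map' := fun v => by
        change ‖D.inl v.fst + D.inr v.snd‖ = _
        rw [← sq_eq_sq₀ (norm_nonneg _) (norm_nonneg _), WithLp.prod_norm_sq_eq_of_L2, sq, sq, sq,
          norm_add_sq_eq_norm_sq_add_norm_sq_of_inner_eq_zero _ _ (D.inner_inl_inr _ _)]
        simp }
  refine ⟨LinearIsometryEquiv.ofSurjective J fun v => ?_, fun s h v => ?_⟩
  · obtain ⟨x, y, h⟩ := D.exists_eq v
    exact ⟨WithLp.toLp 2 (x, y), h.symm⟩
  · change D.inl (ρ₁.op s h v.fst) + D.inr (ρ₂.op s h v.snd) = ρ.op s h (D.inl v.fst + D.inr v.snd)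
    rw [map_add, D.inl_op, D.inr_op]

end

end

end SymWalk

namespace SymWalk

noncomputable section

universe u

open ContinuousLinearMap (adjoint)
open Filter Topology

/-! ### Invariant subspaces and classes in the index group -/

section

variable {S : SymType} {V V₁ V₂ : Type u} [NormedAddCommGroup V] [InnerProductSpace ℂ V]
  [NormedAddCommGroup V₁] [InnerProductSpace ℂ V₁] [NormedAddCommGroup V₂] [InnerProductSpace ℂ V₂]

theorem SymRep.Leaves.orthogonal {ρ : SymRep S V} {K : Submodule ℂ V} (hK : ρ.Leaves K) :
    ρ.Leaves Kᗮ := by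
  intro s h v hv w hw
  have hre : ∀ w ∈ K, (inner ℂ w (ρ.op s h v)).re = 0 := by
    intro w hw
    obtain ⟨u, hu⟩ := (ρ.restrict K hK).op_surjective s h ⟨w, hw⟩
    have hu' : ρ.op s h u = w := congrArg Subtype.val hu
    rw [← hu', ρ.inner_op_re, hv u u.2, Complex.zero_re]
  -- Only real parts are controlled so far. Rescaling w by the inner product itself turns the real
  -- part into the squared modulus.
  have h2 := hre (inner ℂ w (ρ.op s h v) • w) (K.smul_mem _ hw)
  rw [inner_smul_left, mul_comm, Complex.mul_conj, Complex.ofReal_re, Complex.normSq_eq_zero] at h2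
  exact h2

/-- An invariant subspace and its orthogonal complement. -/
def SymRep.splittingOrthogonal (ρ : SymRep S V) (K : Submodule ℂ V) [K.HasOrthogonalProjection]
    (hK : ρ.Leaves K) : ρ.Splitting (ρ.restrict K hK) (ρ.restrict Kᗮ hK.orthogonal) where
  inl := K.subtypeₗᵢ
  inr := Kᗮ.subtypeₗᵢ
  inl_op _ _ _ := rfl
  inr_op _ _ _ := rfl
  inner_inl_inr v w := w.2 v v.2
  exists_eq v := by
    obtain ⟨y, hy, z, hz, h⟩ := K.exists_add_mem_mem_orthogonal v
    exact ⟨⟨y, hy⟩, ⟨z, hz⟩, h⟩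

/-- A finite-dimensional representation as an object. -/
abbrev FinRep.of [FiniteDimensional ℂ V] (ρ : SymRep S V) : FinRep.{u} S := { space := V, rep := ρ }

theorem FinRep.cls_of_uEquiv [FiniteDimensional ℂ V₁] [FiniteDimensional ℂ V₂]
    {ρ₁ : SymRep S V₁} {ρ₂ : SymRep S V₂} (h : ρ₁.UEquiv ρ₂) :
    (FinRep.of ρ₁).cls = (FinRep.of ρ₂).cls :=
  FinRep.cls_eq (.of_uEquiv h)

theorem SymRep.Splitting.cls_eq [FiniteDimensional ℂ V] [FiniteDimensional ℂ V₁]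
    [FiniteDimensional ℂ V₂] {ρ : SymRep S V} {ρ₁ : SymRep S V₁} {ρ₂ : SymRep S V₂}
    (D : ρ.Splitting ρ₁ ρ₂) : (FinRep.of ρ).cls = (FinRep.of ρ₁).cls + (FinRep.of ρ₂).cls :=
  (FinRep.cls_of_uEquiv D.uEquiv).symm

/-- The kernel of a skew-adjoint symmetric operator on a finite-dimensional representation carries
the class of the whole representation. -/
theorem SymRep.cls_ker_of_skew [FiniteDimensional ℂ V] {ρ : SymRep S V} (s : V →ₗ[ℂ] V)
    (hskew : ∀ v w, inner ℂ (s v) w = -inner ℂ v (s w)) (hρ : ρ.Intertwines s (-s))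
    (hK : ρ.Leaves (LinearMap.ker s)) :
    (FinRep.of (ρ.restrict (LinearMap.ker s) hK)).cls = (FinRep.of ρ).cls := by
  set K := LinearMap.ker s with hKs
  have hmap : ∀ v ∈ Kᗮ, s v ∈ Kᗮ := fun v _ w hw => by
    rw [← neg_neg (inner ℂ w (s v)), ← hskew, LinearMap.mem_ker.1 hw, inner_zero_left, neg_zero]
  -- On the orthogonal complement of its kernel s is injective, and `SymRep.IsBalanced.of_skew`
  -- applies.
  have hbal : (FinRep.of (ρ.restrict Kᗮ hK.orthogonal)).rep.IsBalanced := by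
    refine SymRep.IsBalanced.of_skew (s.restrict hmap) (fun v w => hskew v w)
      ⟨fun h v => Subtype.ext (hρ.1 h v), fun h v => Subtype.ext (hρ.2.1 h v),
        fun h v => Subtype.ext (hρ.2.2 h v)⟩ fun v hv => ?_
    have hv' : (v : V) ∈ K := congrArg Subtype.val hv
    exact Subtype.ext (inner_self_eq_zero.1 (v.2 v hv'))
  rw [(ρ.splittingOrthogonal K hK).cls_eq, FinRep.cls_eq_zero hbal, add_zero]

end

/-! ### The kernel of a skew-adjoint operator and its Schur complement -/

section

variable {S : SymType} {V : Type u} [NormedAddCommGroup V] [InnerProductSpace ℂ V]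
  [CompleteSpace V]

/-- Schur complement: with A = (a b; c d) relative to N and its complement and d invertible, ker A
is the graph of -d⁻¹c over the kernel of a - b d⁻¹ c. The latter is skew-adjoint on the
finite-dimensional N, so its kernel carries the class of N. -/
theorem SymRep.cls_ker_eq_of_isUnit_compress {V : Type u} [NormedAddCommGroup V]
    [InnerProductSpace ℂ V] {ρ : SymRep S V} {A : V →L[ℂ] V}
    (hskew : ∀ v w, inner ℂ (A v) w = -inner ℂ v (A w)) (hρ : ρ.Intertwines A (-A))
    {N K : Submodule ℂ V} [FiniteDimensional ℂ N] [FiniteDimensional ℂ K] (hN : ρ.Leaves N)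
    (hK : ρ.Leaves K) (hKA : ∀ v, v ∈ K ↔ A v = 0) (hunit : IsUnit (compress Nᗮ A)) :
    (FinRep.of (ρ.restrict K hK)).cls = (FinRep.of (ρ.restrict N hN)).cls := by
  obtain ⟨e, hde, hed⟩ := isUnit_iff_exists.1 hunit
  have hopA : ∀ s h, ∃ c : ℂ, ∀ v, A (ρ.op s h v) = c • ρ.op s h (A v) := by
    rintro (_ | _ | _) h
    · exact ⟨1, fun v => by rw [one_smul, hρ.1]⟩
    · exact ⟨-1, fun v => by rw [hρ.2.1]; simp⟩
    · exact ⟨-1, fun v => by rw [hρ.2.2]; simp⟩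
  have happ : ∀ m : Nᗮ, compress Nᗮ A m = Nᗮ.orthogonalProjectionOnto (A m) := fun _ => rfl
  -- This makes φ n below the only vector in n + Nᗮ that A maps into N. Equivariance of φ and
  -- surjectivity onto ker A both follow from uniqueness.
  have huniq : ∀ m ∈ Nᗮ, A m ∈ N → m = 0 := by
    intro m hm hAm
    have h1 : compress Nᗮ A ⟨m, hm⟩ = 0 := by
      rw [happ, Submodule.orthogonalProjectionOnto_orthogonal_apply_eq_zero hAm]
    have h2 := DFunLike.congr_fun hed ⟨m, hm⟩
    rw [mul_apply_eq_comp, h1, map_zero] at h2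
    exact (congrArg Subtype.val h2).symm
  let φ : N →ₗ[ℂ] V := N.subtype - Nᗮ.subtype ∘ₗ e.toLinearMap ∘ₗ
    Nᗮ.orthogonalProjectionOnto.toLinearMap ∘ₗ A.toLinearMap ∘ₗ N.subtype
  have hφ : ∀ n : N, φ n - n ∈ Nᗮ := by
    intro n
    simp only [φ, LinearMap.sub_apply, Submodule.subtype_apply, sub_sub_cancel_left]
    exact Nᗮ.neg_mem (Subtype.mem _)
  have hAφ : ∀ n : N, A (φ n) ∈ N := by
    intro n
    refine N.orthogonal_orthogonal.le (Submodule.orthogonalProjectionOnto_eq_zero_iff.1 ?_)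
    have h2 := DFunLike.congr_fun hde (Nᗮ.orthogonalProjectionOnto (A n))
    have h3 : Nᗮ.orthogonalProjectionOnto (A (φ n)) = Nᗮ.orthogonalProjectionOnto (A n) -
      (compress Nᗮ A * e) (Nᗮ.orthogonalProjectionOnto (A n)) := by
      rw [mul_apply_eq_comp, happ, ← map_sub, ← map_sub A]
      rfl
    rw [h3, h2]
    exact sub_self _
  have hφop : ∀ s h (n : N), ρ.op s h (φ n) = φ (ρ.restrict N hN |>.op s h n) := by
    intro s h n
    refine sub_eq_zero.1 (huniq _ ?_ ?_)
    · have h1 := hN.orthogonal s h _ (hφ n)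
      rw [map_sub] at h1
      have h2 := Nᗮ.sub_mem h1 (hφ (ρ.restrict N hN |>.op s h n))
      change ρ.op s h (φ n) - ρ.op s h n - (_ - ρ.op s h n) ∈ _ at h2
      rwa [sub_sub_sub_cancel_right] at h2
    · rw [map_sub]
      refine N.sub_mem ?_ (hAφ _)
      obtain ⟨c, hc⟩ := hopA s h
      rw [hc]
      exact N.smul_mem c (hN s h _ (hAφ n))
  let s : N →ₗ[ℂ] N := (A.toLinearMap ∘ₗ φ).codRestrict N hAφ
  have hs : ∀ n, (s n : V) = A (φ n) := fun n => rfl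
  -- Since φ m - m is orthogonal to N, s has the same form as φ* A φ and inherits skewness from A.
  have hinner : ∀ n m : N, inner ℂ (A (φ n)) (m : V) = inner ℂ (A (φ n)) (φ m) := by
    intro n m
    have h := hφ m _ (hAφ n)
    rw [inner_sub_right, sub_eq_zero] at h
    exact h.symm
  have hsskew : ∀ v w, inner ℂ (s v) w = -inner ℂ v (s w) := by
    intro v w
    rw [Submodule.coe_inner, Submodule.coe_inner, hs, hs, hinner, hskew,
      ← inner_conj_symm (v : V), hinner, inner_conj_symm]
  have hsρ : (ρ.restrict N hN).Intertwines s (-s) := by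
    refine ⟨fun h v => Subtype.ext ?_, fun h v => Subtype.ext ?_, fun h v => Subtype.ext ?_⟩
    · exact (hρ.1 h (φ v)).trans (congrArg A (hφop _ h v))
    · exact (hρ.2.1 h (φ v)).trans (congrArg (-A) (hφop _ h v))
    · exact (hρ.2.2 h (φ v)).trans (congrArg (-A) (hφop _ h v))
  have hkerop : (ρ.restrict N hN).Leaves (LinearMap.ker s) := by
    intro t h v hv
    rw [LinearMap.mem_ker] at hv ⊢
    cases t
    · rw [← hsρ.1, hv, map_zero]
    · rw [← neg_eq_zero]
      exact (hsρ.2.1 h v).symm.trans (by rw [hv, map_zero])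
    · rw [← neg_eq_zero]
      exact (hsρ.2.2 h v).symm.trans (by rw [hv, map_zero])
  rw [← SymRep.cls_ker_of_skew s hsskew hsρ hkerop]
  symm
  have hmem : ∀ n : LinearMap.ker s, φ n ∈ K := fun n => (hKA _).2 (congrArg Subtype.val n.2)
  -- φ identifies ker s with ker A equivariantly but not isometrically; `SymRep.UEquiv.of_linear`
  -- repairs this.
  let T : LinearMap.ker s →ₗ[ℂ] K := (φ ∘ₗ (LinearMap.ker s).subtype).codRestrict K hmem
  have hT : Function.Bijective T := by
    constructor
    · rw [← LinearMap.ker_eq_bot, LinearMap.ker_eq_bot']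
      intro n hn
      have h0 : φ n = 0 := congrArg Subtype.val hn
      have h1 := hφ n _ n.1.2
      rw [h0, zero_sub, inner_neg_right, neg_eq_zero, inner_self_eq_zero] at h1
      exact Subtype.ext (Subtype.ext h1)
    · intro v
      obtain ⟨n, hn, m, hm, hv⟩ := N.exists_add_mem_mem_orthogonal (v : V)
      have hAv := (hKA v).1 v.2
      have h1 : (v : V) - φ ⟨n, hn⟩ = 0 := by
        refine huniq _ ?_ ?_
        · have := Nᗮ.sub_mem hm (hφ ⟨n, hn⟩)
          rwa [hv, show n + m - φ ⟨n, hn⟩ = m - (φ ⟨n, hn⟩ - n) by abel]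
        · rw [map_sub, hAv, zero_sub]
          exact N.neg_mem (hAφ _)
      refine ⟨⟨⟨n, hn⟩, Subtype.ext ?_⟩, Subtype.ext (sub_eq_zero.1 h1).symm⟩
      rw [hs, ← sub_eq_zero.1 h1, hAv]
      rfl
  exact FinRep.cls_of_uEquiv (SymRep.UEquiv.of_linear (LinearEquiv.ofBijective T hT)
    fun t h v => Subtype.ext (hφop t h v).symm)

/-! ### Fredholm operators -/

/-- Otherwise there are unit vectors v in M with A v → 0. As v = R A v - (R A - 1) v and the last
term is compact, a subsequence converges, and its limit is a unit vector of M annihilated by A. -/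
theorem exists_bounded_below_of_compact {V : Type u} [NormedAddCommGroup V]
    [InnerProductSpace ℂ V] {A R : V →L[ℂ] V}
    (hR : IsCompactOperator (R * A - 1 : V →L[ℂ] V)) {M : Submodule ℂ V} (hM : IsClosed (M : Set V))
    (hinj : ∀ v ∈ M, A v = 0 → v = 0) : ∃ c > 0, ∀ v ∈ M, c * ‖v‖ ≤ ‖A v‖ := by
  by_contra! hcon
  have hseq : ∀ n : ℕ, ∃ v ∈ M, ‖v‖ = 1 ∧ ‖A v‖ ≤ 1 / ((n : ℝ) + 1) := by
    intro n
    obtain ⟨v, hv, hlt⟩ := hcon (1 / ((n : ℝ) + 1)) (by positivity)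
    have hv0 : v ≠ 0 := by
      rintro rfl
      simp at hlt
    refine ⟨((‖v‖⁻¹ : ℝ) : ℂ) • v, M.smul_mem _ hv, ?_, ?_⟩
    · rw [norm_smul]
      simp [hv0]
    · rw [map_smul, norm_smul, Complex.norm_real, norm_inv, norm_norm, inv_mul_le_iff₀ (by simpa),
        mul_comm]
      exact hlt.le
  choose v hvM hv1 hvA using hseq
  have hA0 : Tendsto (fun n => A (v n)) atTop (𝓝 0) :=
    squeeze_zero_norm hvA tendsto_one_div_add_atTop_nhds_zero_nat
  obtain ⟨C, hC, hsub⟩ := hR.image_closedBall_subset_compact (𝕜₁ := ℂ)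
    (f := (R * A - 1 : V →L[ℂ] V).toLinearMap) 1
  obtain ⟨w, -, g, hg, hw⟩ := hC.tendsto_subseq (x := fun n => (R * A - 1) (v n)) fun n =>
    hsub ⟨v n, by simp [hv1], rfl⟩
  have hRA : Tendsto (fun n => R (A (v (g n)))) atTop (𝓝 0) := by
    have h := (R.continuous.tendsto 0).comp (hA0.comp hg.tendsto_atTop)
    rwa [map_zero] at h
  have hlim : Tendsto (fun n => v (g n)) atTop (𝓝 (-w)) := by
    have := hRA.sub hw
    simpa using this
  have hwM : -w ∈ M := hM.mem_of_tendsto hlim (Eventually.of_forall fun n => hvM _)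
  have hAw : A (-w) = 0 :=
    tendsto_nhds_unique ((A.continuous.tendsto _).comp hlim) (hA0.comp hg.tendsto_atTop)
  have h1 : ‖-w‖ = 1 := tendsto_nhds_unique hlim.norm (by simp [hv1])
  rw [hinj _ hwM hAw, norm_zero] at h1
  exact zero_ne_one h1

/-- A skew-adjoint operator maps into the complement of its kernel and is bounded below there, so it
remains to see that its range is dense: a vector y orthogonal to the range satisfies 0 = ⟨A A y, y⟩
= -‖A y‖². -/
theorem isUnit_compress_ker_orthogonal {A R : V →L[ℂ] V}
    (hskew : ∀ v w, inner ℂ (A v) w = -inner ℂ v (A w))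
    (hR : IsCompactOperator (R * A - 1 : V →L[ℂ] V)) {N : Submodule ℂ V}
    [N.HasOrthogonalProjection] (hN : ∀ v, v ∈ N ↔ A v = 0) : IsUnit (compress Nᗮ A) := by
  have hmap : ∀ v, A v ∈ Nᗮ := fun v n hn => by
    rw [← neg_neg (inner ℂ n (A v)), ← hskew, (hN n).1 hn, inner_zero_left, neg_zero]
  have happ : ∀ m : Nᗮ, (compress Nᗮ A m : V) = A m := fun m =>
    Submodule.starProjection_eq_self_iff.2 (hmap m)
  have hinj : ∀ v ∈ Nᗮ, A v = 0 → v = 0 := fun v hv h =>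
    inner_self_eq_zero.1 (hv v ((hN v).2 h))
  obtain ⟨c, hc, hbd⟩ := exists_bounded_below_of_compact hR N.isClosed_orthogonal hinj
  rw [ContinuousLinearMap.isUnit_iff_bijective,
    ContinuousLinearMap.bijective_iff_dense_range_and_antilipschitz]
  constructor
  · rw [Submodule.topologicalClosure_eq_top_iff, Submodule.eq_bot_iff]
    intro y hy
    have hy' : (A y : V) = 0 := by
      have h := hy _ ⟨compress Nᗮ A y, rfl⟩
      change inner ℂ ((compress Nᗮ A (compress Nᗮ A y) : Nᗮ) : V) (y : V) = 0 at h
      rw [happ, happ, hskew, neg_eq_zero, inner_self_eq_zero] at h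
      exact h
    exact Subtype.ext (hinj _ y.2 hy')
  · lift c to NNReal using hc.le
    refine ⟨c⁻¹, (compress Nᗮ A).antilipschitz_of_bound fun m => ?_⟩
    rw [NNReal.coe_inv, inv_mul_eq_div, le_div_iff₀ hc, mul_comm]
    have h := hbd m m.2
    rwa [← happ] at h

/-! ### Homotopy invariance of the symmetry index -/

theorem sub_adjoint_skew (W : V →L[ℂ] V) (v w : V) :
    inner ℂ ((W - adjoint W) v) w = -inner ℂ v ((W - adjoint W) w) := by
  simp only [sub_apply, inner_sub_left, inner_sub_right,
    ContinuousLinearMap.adjoint_inner_left, ContinuousLinearMap.adjoint_inner_right]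
  ring

/-- W - W* has the same kernel as Im W. Without the factor 1/(2i), antilinear symmetries introduce
no extra sign. -/
theorem SymRep.intertwines_sub_adjoint {ρ : SymRep S V} {W : V →L[ℂ] V}
    (hW : ρ.Intertwines W (adjoint W)) :
    ρ.Intertwines (W - adjoint W : V →L[ℂ] V) (-(W - adjoint W : V →L[ℂ] V)) := by
  have hW' := hW.adjoint
  refine ⟨fun h v => ?_, fun h v => ?_, fun h v => ?_⟩
  · simp [hW.1, hW'.1]
  · simp [hW.2.1, hW'.2.1]
  · simp [hW.2.2, hW'.2.2]

theorem mem_imKer_iff_sub_adjoint {W : V →L[ℂ] V} {v : V} :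
    v ∈ imKer W ↔ (W - adjoint W) v = 0 := by
  rw [mem_imKer, sub_apply, sub_eq_zero]

/-- Modulo compacts W (W - W*) = W² - 1 = (W - 1)(W + 1), and R₁, R₂ remove the two factors one
after the other. -/
theorem IsAdmissible.exists_compact_sub_adjoint {ρ : SymRep S V} {W : V →L[ℂ] V}
    (hW : IsAdmissible ρ W) :
    ∃ R : V →L[ℂ] V, IsCompactOperator (R * (W - adjoint W) - 1 : V →L[ℂ] V) := by
  obtain ⟨R₁, h₁⟩ := hW.gap_one
  obtain ⟨R₂, h₂⟩ := hW.gap_neg_one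
  refine ⟨R₂ * R₁ * W, ?_⟩
  have e : R₂ * R₁ * W * (W - adjoint W) - 1 = R₂ * (R₁ * (W - 1) - 1) * (W + 1)
      + (R₂ * (W + 1) - 1) - R₂ * R₁ * (W * adjoint W - 1) := by noncomm_ring
  rw [e]
  exact ((((h₁.clm_comp R₂)).comp_clm (W + 1)).add h₂).sub (hW.compact_right.clm_comp (R₂ * R₁))

theorem IsAdmissible.si_eq {ρ : SymRep S V} {W : V →L[ℂ] V} (hW : IsAdmissible ρ W)
    [FiniteDimensional ℂ (imKer W)] :
    si ρ W = (FinRep.of (ρ.restrict (imKer W) hW.leaves_imKer)).cls :=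
  dif_pos hW

/-- Invertibility is an open condition, so near W₀ the Schur complement can be taken on the fixed
space N = ker(W₀ - W₀*), whose class is the index of W₀. -/
theorem IsAdmissible.eventually_si_eq {ρ : SymRep S V} {W₀ : V →L[ℂ] V}
    (h₀ : IsAdmissible ρ W₀) : ∀ᶠ W in 𝓝 W₀, IsAdmissible ρ W → si ρ W = si ρ W₀ := by
  have := h₀.finite_imKer
  obtain ⟨R, hR⟩ := h₀.exists_compact_sub_adjoint
  have hunit : IsUnit (compress (imKer W₀)ᗮ (W₀ - adjoint W₀)) :=
    isUnit_compress_ker_orthogonal (sub_adjoint_skew W₀) hR fun v => mem_imKer_iff_sub_adjoint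
  have hcont : Continuous fun W : V →L[ℂ] V => compress (imKer W₀)ᗮ (W - adjoint W) := by
    unfold compress
    exact continuous_const.clm_comp ((continuous_id.sub
      (adjoint : (V →L[ℂ] V) ≃ₗᵢ⋆[ℂ] (V →L[ℂ] V)).continuous).clm_comp continuous_const)
  have hnhds := (Units.isOpen (R := (imKer W₀)ᗮ →L[ℂ] (imKer W₀)ᗮ)).mem_nhds hunit
  filter_upwards [hcont.continuousAt.eventually hnhds] with W hWu hW
  have := hW.finite_imKer
  rw [hW.si_eq, h₀.si_eq]
  exact SymRep.cls_ker_eq_of_isUnit_compress (sub_adjoint_skew W)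
    (SymRep.intertwines_sub_adjoint hW.symmetric) _ _
    (fun v => mem_imKer_iff_sub_adjoint) hWu

/-- The symmetry index is constant along continuous paths. -/
theorem si_eq_of_path {ρ : SymRep S V} (w : unitInterval → V →L[ℂ] V) (hw : Continuous w)
    (hadm : ∀ t, IsAdmissible ρ (w t)) : si ρ (w 1) = si ρ (w 0) := by
  have h : IsLocallyConstant fun t => si ρ (w t) := by
    rw [IsLocallyConstant.iff_eventually_eq]
    intro t
    filter_upwards [hw.continuousAt.eventually (hadm t).eventually_si_eq] with t' ht'
    exact ht' (hadm t')
  exact h.apply_eq_of_isPreconnected isPreconnected_univ trivial trivial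

end

end

end SymWalk

namespace SymWalk

noncomputable section

set_option linter.unusedSectionVars false

universe u

open ContinuousLinearMap (adjoint)

/-! ### Compact perturbations -/

section

variable {S : SymType} {V : Type u} [NormedAddCommGroup V] [InnerProductSpace ℂ V]
  [CompleteSpace V]

theorem IsAdmissible.add_compact {ρ : SymRep S V} {W C : V →L[ℂ] V} (hW : IsAdmissible ρ W)
    (hC : IsCompactOperator C) (hC' : IsCompactOperator (adjoint C))
    (hsymm : ρ.Intertwines (W + C) (adjoint (W + C))) : IsAdmissible ρ (W + C) := by
  refine ⟨?_, ?_, hsymm, ?_, ?_⟩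
  · have e : adjoint (W + C) * (W + C) - 1 =
        adjoint W * W - 1 + adjoint W * C + adjoint C * (W + C) := by
      rw [map_add]
      noncomm_ring
    rw [e]
    exact (hW.compact_left.add (hC.clm_comp (adjoint W))).add (hC'.comp_clm (W + C))
  · have e : (W + C) * adjoint (W + C) - 1 =
        W * adjoint W - 1 + C * adjoint (W + C) + W * adjoint C := by
      rw [map_add]
      noncomm_ring
    rw [e]
    exact (hW.compact_right.add (hC.comp_clm (adjoint (W + C)))).add (hC'.clm_comp W)
  · obtain ⟨R, hR⟩ := hW.gap_one
    refine ⟨R, ?_⟩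
    rw [show R * (W + C - 1) - 1 = R * (W - 1) - 1 + R * C by noncomm_ring]
    exact hR.add (hC.clm_comp R)
  · obtain ⟨R, hR⟩ := hW.gap_neg_one
    refine ⟨R, ?_⟩
    rw [show R * (W + C + 1) - 1 = R * (W + 1) - 1 + R * C by noncomm_ring]
    exact hR.add (hC.clm_comp R)

/-- Schauder's theorem is not needed: since adjoints are inverses modulo compacts, W'* - W* equals
-W'*(W' - W)W* up to compacts, as for a difference of inverses. -/
theorem IsAdmissible.isCompactOperator_adjoint_sub {ρ : SymRep S V} {W W' : V →L[ℂ] V}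
    (hW : IsAdmissible ρ W) (hW' : IsAdmissible ρ W') (hc : IsCompactOperator (W' - W)) :
    IsCompactOperator (adjoint (W' - W)) := by
  have e : adjoint (W' - W) = adjoint W' * -(W' - W) * adjoint W
      - adjoint W' * (W * adjoint W - 1) + (adjoint W' * W' - 1) * adjoint W := by
    rw [map_sub]
    noncomm_ring
  rw [e]
  exact (((hc.neg.clm_comp (adjoint W')).comp_clm (adjoint W)).sub
    (hW.compact_right.clm_comp (adjoint W'))).add (hW'.compact_left.comp_clm (adjoint W))

/-- Compact perturbations do not change the symmetry index. -/
theorem IsAdmissible.si_eq_of_compact {ρ : SymRep S V} {W W' : V →L[ℂ] V}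
    (hW : IsAdmissible ρ W) (hW' : IsAdmissible ρ W') (hc : IsCompactOperator (W' - W)) :
    si ρ W' = si ρ W := by
  have hc' := hW.isCompactOperator_adjoint_sub hW' hc
  -- The path is the segment from W to W'. Its real coefficients preserve the symmetry relations,
  -- and each point differs from W by a compact operator.
  have h := si_eq_of_path (ρ := ρ) (fun t => W + ((t : ℝ) : ℂ) • (W' - W)) (by fun_prop) fun t => ?_
  · simpa using h
  · generalize (t : ℝ) = c
    refine hW.add_compact (hc.smul _) ?_ ?_
    · rw [map_smulₛₗ]
      exact hc'.smul _
    · have h := hW.symmetric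
      have h' := hW'.symmetric
      have e : adjoint (W + (c : ℂ) • (W' - W)) =
          adjoint W + (c : ℂ) • (adjoint W' - adjoint W) := by
        rw [map_add, map_smulₛₗ, map_sub, Complex.conj_ofReal]
      rw [e]
      refine ⟨fun g v => ?_, fun g v => ?_, fun g v => ?_⟩
      · change ρ.op _ g (W v + (c : ℂ) • (W' v - W v)) = W _ + (c : ℂ) • (W' _ - W _)
        rw [map_add, ρ.op_real_smul, map_sub, h.1, h'.1]
      · change ρ.op _ g (W v + (c : ℂ) • (W' v - W v)) =
          adjoint W _ + (c : ℂ) • (adjoint W' _ - adjoint W _)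
        rw [map_add, ρ.op_real_smul, map_sub, h.2.1, h'.2.1]
      · change ρ.op _ g (W v + (c : ℂ) • (W' v - W v)) =
          adjoint W _ + (c : ℂ) • (adjoint W' _ - adjoint W _)
        rw [map_add, ρ.op_real_smul, map_sub, h.2.2, h'.2.2]

/-- Every operator satisfying the symmetry relations of a balanced finite-dimensional
representation has vanishing index. -/
theorem SymRep.IsBalanced.si_eq_zero [FiniteDimensional ℂ V] {ρ : SymRep S V} (h : ρ.IsBalanced)
    {W : V →L[ℂ] V} (hW : IsAdmissible ρ W) : si ρ W = 0 := by
  obtain ⟨U, hU, h1, h2⟩ := h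
  have hcpt : ∀ A : V →L[ℂ] V, IsCompactOperator A := fun A =>
    haveI := FiniteDimensional.proper ℂ V
    isCompactOperator_of_locallyCompactSpace_dom A
  let X : V →L[ℂ] V := (U.toContinuousLinearEquiv : V →L[ℂ] V)
  have hXadj : adjoint X = (U.symm.toContinuousLinearEquiv : V →L[ℂ] V) := U.adjoint_eq_symm
  have hsymm : ρ.Intertwines X (adjoint X) := by
    rw [hXadj]
    exact hU
  have hXadm : IsAdmissible ρ X :=
    -- In finite dimensions the compactness conditions are vacuous, so R = 0 serves for both gaps.
    ⟨hcpt _, hcpt _, hsymm, ⟨0, hcpt _⟩, ⟨0, hcpt _⟩⟩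
  have hker : Subsingleton (imKer X) := by
    refine ⟨fun v w => Subtype.ext (?_ : (v : V) = w)⟩
    have hzero : ∀ v ∈ imKer X, v = 0 := by
      intro v hv
      rw [mem_imKer, hXadj] at hv
      have hv' : U v = U.symm v := hv
      -- From U v = U⁻¹ v it follows that U fixes U v + v. The missing eigenvalue 1 forces U v = -v,
      -- and the missing eigenvalue -1 then forces v = 0.
      have h3 : U v + v = 0 := h1 _ (by rw [map_add, hv', U.apply_symm_apply, add_comm])
      exact h2 v (eq_neg_of_add_eq_zero_left h3)
    rw [hzero v v.2, hzero w w.2]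
  rw [hXadm.si_eq_of_compact hW (hcpt _), hXadm.si_eq]
  exact FinRep.cls_eq_zero (SymRep.isBalanced_of_subsingleton _)

end

/-! ### Block operators with respect to a splitting -/

namespace SymRep.Splitting

variable {S : SymType} {V V₁ V₂ : Type u} [NormedAddCommGroup V] [InnerProductSpace ℂ V]
  [NormedAddCommGroup V₁] [InnerProductSpace ℂ V₁] [NormedAddCommGroup V₂] [InnerProductSpace ℂ V₂]
  {ρ : SymRep S V} {ρ₁ : SymRep S V₁} {ρ₂ : SymRep S V₂} (D : ρ.Splitting ρ₁ ρ₂)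

/-- Exchange the two summands. -/
def swap : ρ.Splitting ρ₂ ρ₁ where
  inl := D.inr
  inr := D.inl
  inl_op := D.inr_op
  inr_op := D.inl_op
  inner_inl_inr v w := by rw [← inner_conj_symm, D.inner_inl_inr, map_zero]
  exists_eq v := by
    obtain ⟨x, y, h⟩ := D.exists_eq v
    exact ⟨y, x, h.trans (add_comm _ _)⟩

/-- The inclusion of the left summand. -/
def incl : V₁ →L[ℂ] V := D.inl.toContinuousLinearMap

theorem incl_op (s : Sym) (h : (S.sq s).isSome) (v : V₁) :
    D.incl (ρ₁.op s h v) = ρ.op s h (D.incl v) := D.inl_op s h v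

theorem incl_injective : Function.Injective D.incl := D.inl.injective

variable [CompleteSpace V] [CompleteSpace V₁] [CompleteSpace V₂]

/-- The projection onto the left summand. -/
def proj : V →L[ℂ] V₁ := adjoint D.incl

/-- The left diagonal block of `W`. -/
def diag (W : V →L[ℂ] V) : V₁ →L[ℂ] V₁ := D.proj ∘L W ∘L D.incl

/-- The off-diagonal block of `W` from the left to the right summand. -/
def offdiag (W : V →L[ℂ] V) : V₁ →L[ℂ] V₂ := D.swap.proj ∘L W ∘L D.incl

/-- The operator with diagonal blocks `A` and `B`. -/
def block (A : V₁ →L[ℂ] V₁) (B : V₂ →L[ℂ] V₂) : V →L[ℂ] V :=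
  D.incl ∘L A ∘L D.proj + D.swap.incl ∘L B ∘L D.swap.proj

theorem proj_incl (v : V₁) : D.proj (D.incl v) = v :=
  ext_inner_left ℂ fun w => by
    rw [proj, ContinuousLinearMap.adjoint_inner_right]
    exact D.inl.inner_map_map w v

theorem swap_proj_incl (v : V₁) : D.swap.proj (D.incl v) = 0 :=
  ext_inner_left ℂ fun w => by
    rw [proj, ContinuousLinearMap.adjoint_inner_right, inner_zero_right]
    exact D.swap.inner_inl_inr w v

theorem proj_swap_incl (v : V₂) : D.proj (D.swap.incl v) = 0 := D.swap.swap_proj_incl v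

theorem incl_proj_add (v : V) : D.incl (D.proj v) + D.swap.incl (D.swap.proj v) = v := by
  obtain ⟨x, y, h⟩ := D.exists_eq v
  have h' : v = D.incl x + D.swap.incl y := h
  rw [h', map_add, map_add, proj_incl, proj_swap_incl, map_add D.swap.proj, swap_proj_incl,
    proj_incl, map_add, map_zero, add_zero, map_zero, zero_add]

theorem proj_op (s : Sym) (h : (S.sq s).isSome) (v : V) :
    D.proj (ρ.op s h v) = ρ₁.op s h (D.proj v) := by
  have hadj : ∀ v w, inner ℂ (D.incl v) w = inner ℂ v (D.proj w) := fun v w =>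
    (ContinuousLinearMap.adjoint_inner_right _ _ _).symm
  exact (ρ₁.intertwines_adjoint ρ s h hadj hadj (fun v => (D.incl_op s h v).symm) v).symm

theorem adjoint_diag (W : V →L[ℂ] V) : adjoint (D.diag W) = D.diag (adjoint W) := by
  simp only [diag, proj, ContinuousLinearMap.adjoint_comp, ContinuousLinearMap.adjoint_adjoint]
  rfl

/-- Inserting the two complementary projections between A and B shows that passing to a diagonal
block is multiplicative up to a product of off-diagonal blocks. -/
theorem diag_mul_diag (A B : V →L[ℂ] V) :
    D.diag A * D.diag B = D.diag (A * B) - D.swap.offdiag A ∘L D.offdiag B := by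
  ext v
  have h := D.incl_proj_add (B (D.incl v))
  rw [← eq_sub_iff_add_eq] at h
  change D.proj (A (D.incl (D.proj (B (D.incl v))))) =
    D.proj (A (B (D.incl v))) - D.proj (A (D.swap.incl (D.swap.proj (B (D.incl v)))))
  rw [h, map_sub, map_sub]

theorem diag_one : D.diag 1 = 1 := by
  ext v
  exact D.proj_incl v

theorem diag_add (A B : V →L[ℂ] V) : D.diag (A + B) = D.diag A + D.diag B := by
  ext v
  simp [diag]

theorem diag_sub (A B : V →L[ℂ] V) : D.diag (A - B) = D.diag A - D.diag B := by
  ext v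
  simp [diag]

theorem isCompactOperator_diag {W : V →L[ℂ] V} (hW : IsCompactOperator W) :
    IsCompactOperator (D.diag W) :=
  (hW.comp_clm D.incl).clm_comp D.proj

/-- In every product occurring in the definition, the error term of `diag_mul_diag` contains an
off-diagonal block of W itself, so no compactness is required of the blocks of W* or R. -/
theorem isAdmissible_diag {W : V →L[ℂ] V} (hW : IsAdmissible ρ W)
    (h₁ : IsCompactOperator (D.offdiag W)) (h₂ : IsCompactOperator (D.swap.offdiag W)) :
    IsAdmissible ρ₁ (D.diag W) := by
  refine ⟨?_, ?_, ⟨fun h v => ?_, fun h v => ?_, fun h v => ?_⟩, ?_, ?_⟩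
  · rw [adjoint_diag, diag_mul_diag, sub_right_comm, ← D.diag_one, ← diag_sub]
    exact (D.isCompactOperator_diag hW.compact_left).sub (h₁.clm_comp (D.swap.offdiag (adjoint W)))
  · rw [adjoint_diag, diag_mul_diag, sub_right_comm, ← D.diag_one, ← diag_sub]
    exact (D.isCompactOperator_diag hW.compact_right).sub (h₂.comp_clm _)
  · change ρ₁.op _ h (D.proj (W (D.incl v))) = D.proj (W (D.incl (ρ₁.op _ h v)))
    rw [← proj_op, hW.symmetric.1, incl_op]
  · rw [adjoint_diag]
    change ρ₁.op _ h (D.proj (W (D.incl v))) = D.proj (adjoint W (D.incl (ρ₁.op _ h v)))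
    rw [← proj_op, hW.symmetric.2.1, incl_op]
  · rw [adjoint_diag]
    change ρ₁.op _ h (D.proj (W (D.incl v))) = D.proj (adjoint W (D.incl (ρ₁.op _ h v)))
    rw [← proj_op, hW.symmetric.2.2, incl_op]
  · obtain ⟨R, hR⟩ := hW.gap_one
    refine ⟨D.diag R, ?_⟩
    have e : D.offdiag (W - 1) = D.offdiag W := by
      ext v
      simp [offdiag, swap_proj_incl]
    rw [← D.diag_one, ← diag_sub, diag_mul_diag, sub_right_comm, ← diag_sub, e]
    exact (D.isCompactOperator_diag hR).sub (h₁.clm_comp (D.swap.offdiag R))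
  · obtain ⟨R, hR⟩ := hW.gap_neg_one
    refine ⟨D.diag R, ?_⟩
    have e : D.offdiag (W + 1) = D.offdiag W := by
      ext v
      simp [offdiag, swap_proj_incl]
    rw [← D.diag_one, ← diag_add, diag_mul_diag, sub_right_comm, ← diag_sub, e]
    exact (D.isCompactOperator_diag hR).sub (h₁.clm_comp (D.swap.offdiag R))

theorem block_mul_block (A A' : V₁ →L[ℂ] V₁) (B B' : V₂ →L[ℂ] V₂) :
    D.block A B * D.block A' B' = D.block (A * A') (B * B') := by
  ext v
  simp [block, proj_incl, proj_swap_incl, swap_proj_incl]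

theorem block_one : D.block 1 1 = 1 := by
  ext v
  exact D.incl_proj_add v

theorem block_sub (A A' : V₁ →L[ℂ] V₁) (B B' : V₂ →L[ℂ] V₂) :
    D.block (A - A') (B - B') = D.block A B - D.block A' B' := by
  ext v
  simp [block]
  abel

theorem block_add (A A' : V₁ →L[ℂ] V₁) (B B' : V₂ →L[ℂ] V₂) :
    D.block (A + A') (B + B') = D.block A B + D.block A' B' := by
  ext v
  simp [block]
  abel

theorem adjoint_block (A : V₁ →L[ℂ] V₁) (B : V₂ →L[ℂ] V₂) :
    adjoint (D.block A B) = D.block (adjoint A) (adjoint B) := by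
  simp only [block, proj, map_add, ContinuousLinearMap.adjoint_comp,
    ContinuousLinearMap.adjoint_adjoint]
  rfl

theorem isCompactOperator_block {A : V₁ →L[ℂ] V₁} {B : V₂ →L[ℂ] V₂} (hA : IsCompactOperator A)
    (hB : IsCompactOperator B) : IsCompactOperator (D.block A B) :=
  ((hA.comp_clm D.proj).clm_comp D.incl).add ((hB.comp_clm D.swap.proj).clm_comp D.swap.incl)

theorem isAdmissible_block {A : V₁ →L[ℂ] V₁} {B : V₂ →L[ℂ] V₂} (hA : IsAdmissible ρ₁ A)
    (hB : IsAdmissible ρ₂ B) : IsAdmissible ρ (D.block A B) := by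
  refine ⟨?_, ?_, ⟨fun h v => ?_, fun h v => ?_, fun h v => ?_⟩, ?_, ?_⟩
  · rw [adjoint_block, block_mul_block, ← D.block_one, ← block_sub]
    exact D.isCompactOperator_block hA.compact_left hB.compact_left
  · rw [adjoint_block, block_mul_block, ← D.block_one, ← block_sub]
    exact D.isCompactOperator_block hA.compact_right hB.compact_right
  · simp [block, proj_op, ← incl_op, hA.symmetric.1, hB.symmetric.1]
  · rw [adjoint_block]
    simp [block, proj_op, ← incl_op, hA.symmetric.2.1, hB.symmetric.2.1]
  · rw [adjoint_block]
    simp [block, proj_op, ← incl_op, hA.symmetric.2.2, hB.symmetric.2.2]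
  · obtain ⟨R, hR⟩ := hA.gap_one
    obtain ⟨R', hR'⟩ := hB.gap_one
    refine ⟨D.block R R', ?_⟩
    rw [← D.block_one, ← block_sub, block_mul_block, ← block_sub]
    exact D.isCompactOperator_block hR hR'
  · obtain ⟨R, hR⟩ := hA.gap_neg_one
    obtain ⟨R', hR'⟩ := hB.gap_neg_one
    refine ⟨D.block R R', ?_⟩
    rw [← D.block_one, ← block_add, block_mul_block, ← block_sub]
    exact D.isCompactOperator_block hR hR'

theorem block_incl (A : V₁ →L[ℂ] V₁) (B : V₂ →L[ℂ] V₂) (v : V₁) :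
    D.block A B (D.incl v) = D.incl (A v) := by
  simp [block, proj_incl, swap_proj_incl]

theorem block_swap_incl (A : V₁ →L[ℂ] V₁) (B : V₂ →L[ℂ] V₂) (v : V₂) :
    D.block A B (D.swap.incl v) = D.swap.incl (B v) := by
  simp [block, proj_incl, proj_swap_incl]

theorem incl_mem_imKer {A : V₁ →L[ℂ] V₁} {B : V₂ →L[ℂ] V₂} {v : V₁} :
    D.incl v ∈ imKer (D.block A B) ↔ v ∈ imKer A := by
  rw [mem_imKer, mem_imKer, adjoint_block, block_incl, block_incl, D.incl_injective.eq_iff]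

theorem swap_incl_mem_imKer {A : V₁ →L[ℂ] V₁} {B : V₂ →L[ℂ] V₂} {v : V₂} :
    D.swap.incl v ∈ imKer (D.block A B) ↔ v ∈ imKer B := by
  rw [mem_imKer, mem_imKer, adjoint_block, block_swap_incl, block_swap_incl,
    D.swap.incl_injective.eq_iff]

theorem proj_mem_imKer {A : V₁ →L[ℂ] V₁} {B : V₂ →L[ℂ] V₂} {v : V}
    (hv : v ∈ imKer (D.block A B)) : D.proj v ∈ imKer A ∧ D.swap.proj v ∈ imKer B := by
  rw [mem_imKer, adjoint_block] at hv
  constructor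
  · rw [mem_imKer]
    simpa [block, proj_incl, proj_swap_incl, swap_proj_incl] using congrArg D.proj hv
  · rw [mem_imKer]
    simpa [block, proj_incl, proj_swap_incl, swap_proj_incl] using congrArg D.swap.proj hv

/-- The kernel of the imaginary part of a block diagonal operator splits. -/
def imKerSplitting {A : V₁ →L[ℂ] V₁} {B : V₂ →L[ℂ] V₂} (hA : ρ₁.Leaves (imKer A))
    (hB : ρ₂.Leaves (imKer B)) (h : ρ.Leaves (imKer (D.block A B))) :
    (ρ.restrict _ h).Splitting (ρ₁.restrict _ hA) (ρ₂.restrict _ hB) where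
  inl :=
    { toLinearMap := D.incl.toLinearMap.restrict fun _ hv => D.incl_mem_imKer.2 hv
      norm_map' := fun v => D.inl.norm_map v }
  inr :=
    { toLinearMap := D.swap.incl.toLinearMap.restrict fun _ hv => D.swap_incl_mem_imKer.2 hv
      norm_map' := fun v => D.inr.norm_map v }
  inl_op s h v := Subtype.ext (D.inl_op s h v)
  inr_op s h v := Subtype.ext (D.inr_op s h v)
  inner_inl_inr v w := D.inner_inl_inr v w
  exists_eq v := ⟨⟨_, (D.proj_mem_imKer v.2).1⟩, ⟨_, (D.proj_mem_imKer v.2).2⟩,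
    Subtype.ext (D.incl_proj_add v).symm⟩

theorem si_block {A : V₁ →L[ℂ] V₁} {B : V₂ →L[ℂ] V₂} (hA : IsAdmissible ρ₁ A)
    (hB : IsAdmissible ρ₂ B) : si ρ (D.block A B) = si ρ₁ A + si ρ₂ B := by
  have h := D.isAdmissible_block hA hB
  have := hA.finite_imKer
  have := hB.finite_imKer
  have := h.finite_imKer
  rw [hA.si_eq, hB.si_eq, h.si_eq]
  exact (D.imKerSplitting hA.leaves_imKer hB.leaves_imKer h.leaves_imKer).cls_eq

/-- The symmetry index is additive for operators with compact off-diagonal blocks. -/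
theorem si_eq_add {W : V →L[ℂ] V} (hW : IsAdmissible ρ W) (h₁ : IsCompactOperator (D.offdiag W))
    (h₂ : IsCompactOperator (D.swap.offdiag W)) :
    si ρ W = si ρ₁ (D.diag W) + si ρ₂ (D.swap.diag W) := by
  have hA := D.isAdmissible_diag hW h₁ h₂
  have hB := D.swap.isAdmissible_diag hW h₂ h₁
  rw [← D.si_block hA hB]
  refine (D.isAdmissible_block hA hB).si_eq_of_compact hW ?_
  have e : W - D.block (D.diag W) (D.swap.diag W) = D.swap.incl ∘L D.offdiag W ∘L D.proj +
      D.incl ∘L D.swap.offdiag W ∘L D.swap.proj := by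
    ext v
    have h0 := D.incl_proj_add v
    have h1 := D.incl_proj_add (W (D.incl (D.proj v)))
    have h2 := D.incl_proj_add (W (D.swap.incl (D.swap.proj v)))
    change W v - (D.incl (D.proj (W (D.incl (D.proj v)))) +
      D.swap.incl (D.swap.proj (W (D.swap.incl (D.swap.proj v))))) =
      D.swap.incl (D.swap.proj (W (D.incl (D.proj v)))) +
      D.incl (D.proj (W (D.swap.incl (D.swap.proj v))))
    have h3 : W v = W (D.incl (D.proj v)) + W (D.swap.incl (D.swap.proj v)) := by
      rw [← map_add, h0]
    rw [h3, sub_eq_iff_eq_add]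
    exact (congrArg₂ (· + ·) h1.symm h2.symm).trans (by abel)
  rw [e]
  exact ((h₁.comp_clm D.proj).clm_comp D.swap.incl).add
    ((h₂.comp_clm D.swap.proj).clm_comp D.incl)

end SymRep.Splitting

end

end SymWalk

namespace SymWalk

noncomputable section

set_option linter.unusedSectionVars false

universe u

open ContinuousLinearMap (adjoint)

/-! ### Splittings of invariant subspaces and compressions -/

section

variable {S : SymType} {V V₁ V₂ : Type u} [NormedAddCommGroup V] [InnerProductSpace ℂ V]
  [NormedAddCommGroup V₁] [InnerProductSpace ℂ V₁] [NormedAddCommGroup V₂] [InnerProductSpace ℂ V₂]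
  [CompleteSpace V]

/-- Two orthogonal equivariant copies of complete spaces with trivial joint orthogonal complement
form a splitting. -/
def SymRep.Splitting.ofOrthogonal [CompleteSpace V₁] [CompleteSpace V₂] {ρ : SymRep S V}
    {ρ₁ : SymRep S V₁} {ρ₂ : SymRep S V₂} (inl : V₁ →ₗᵢ[ℂ] V) (inr : V₂ →ₗᵢ[ℂ] V)
    (inl_op : ∀ s h v, inl (ρ₁.op s h v) = ρ.op s h (inl v))
    (inr_op : ∀ s h v, inr (ρ₂.op s h v) = ρ.op s h (inr v))
    (inner_inl_inr : ∀ v w, inner ℂ (inl v) (inr w) = 0)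
    (hzero : ∀ r, (∀ v, inner ℂ (inl v) r = 0) → (∀ w, inner ℂ (inr w) r = 0) → r = 0) :
    ρ.Splitting ρ₁ ρ₂ where
  inl := inl
  inr := inr
  inl_op := inl_op
  inr_op := inr_op
  inner_inl_inr := inner_inl_inr
  exists_eq v := by
    -- The components are the orthogonal projections; the remainder is orthogonal to both copies and
    -- hence zero.
    refine ⟨adjoint inl.toContinuousLinearMap v, adjoint inr.toContinuousLinearMap v, ?_⟩
    rw [← sub_eq_zero]
    refine hzero _ (fun x => ?_) fun y => ?_
    · rw [inner_sub_right, inner_add_right, inner_inl_inr, inl.inner_map_map,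
        ContinuousLinearMap.adjoint_inner_right, add_zero]
      exact sub_self _
    · rw [inner_sub_right, inner_add_right, ← inner_conj_symm (inr y) (inl _), inner_inl_inr,
        inr.inner_map_map, ContinuousLinearMap.adjoint_inner_right, map_zero, zero_add]
      exact sub_self _

theorem SymRep.Splitting.inner_diag [CompleteSpace V₁] {ρ : SymRep S V} {ρ₁ : SymRep S V₁}
    {ρ₂ : SymRep S V₂} (D : ρ.Splitting ρ₁ ρ₂) (W : V →L[ℂ] V) (v w : V₁) :
    inner ℂ v (D.diag W w) = inner ℂ (D.incl v) (W (D.incl w)) :=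
  ContinuousLinearMap.adjoint_inner_right D.incl v (W (D.incl w))

/-- The inclusion of a subspace into a larger one. -/
def inclusionₗᵢ {K K' : Submodule ℂ V} (h : K ≤ K') : K →ₗᵢ[ℂ] K' where
  toLinearMap := Submodule.inclusion h
  norm_map' _ := rfl

/-- The splitting of an invariant subspace into two orthogonal ones. -/
def SymRep.splittingOfLE (ρ : SymRep S V) {K K₁ K₂ : Submodule ℂ V} [CompleteSpace K]
    [CompleteSpace K₁] [CompleteSpace K₂] (hK : ρ.Leaves K) (hK₁ : ρ.Leaves K₁)
    (hK₂ : ρ.Leaves K₂) (h₁ : K₁ ≤ K) (h₂ : K₂ ≤ K) (horth : K₁ ⟂ K₂)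
    (hzero : ∀ r ∈ K, r ∈ K₁ᗮ → r ∈ K₂ᗮ → r = 0) :
    (ρ.restrict K hK).Splitting (ρ.restrict K₁ hK₁) (ρ.restrict K₂ hK₂) :=
  .ofOrthogonal (inclusionₗᵢ h₁) (inclusionₗᵢ h₂) (fun _ _ _ => rfl) (fun _ _ _ => rfl)
    (fun v w => horth.inner_eq v.2 w.2)
    fun r hl hr => Subtype.ext (hzero r r.2 (fun v hv => hl ⟨v, hv⟩) fun v hv => hr ⟨v, hv⟩)

theorem SymRep.coe_splittingOfLE_inl (ρ : SymRep S V) {K K₁ K₂ : Submodule ℂ V} [CompleteSpace K]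
    [CompleteSpace K₁] [CompleteSpace K₂] (hK : ρ.Leaves K) (hK₁ : ρ.Leaves K₁)
    (hK₂ : ρ.Leaves K₂) (h₁ : K₁ ≤ K) (h₂ : K₂ ≤ K) (horth : K₁ ⟂ K₂)
    (hzero : ∀ r ∈ K, r ∈ K₁ᗮ → r ∈ K₂ᗮ → r = 0) (v : K₁) :
    ((ρ.splittingOfLE hK hK₁ hK₂ h₁ h₂ horth hzero).inl v : V) = v := rfl

theorem inner_compress (K : Submodule ℂ V) [K.HasOrthogonalProjection] (W : V →L[ℂ] V) (v w : K) :
    inner ℂ v (compress K W w) = inner ℂ (v : V) (W w) :=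
  K.inner_orthogonalProjectionOnto_eq_of_mem_left v (W w)

theorem SymRep.Splitting.diag_eq_compress {ρ : SymRep S V} {K : Submodule ℂ V} [CompleteSpace K]
    {hK : ρ.Leaves K} {ρ₂ : SymRep S V₂} (D : ρ.Splitting (ρ.restrict K hK) ρ₂)
    (hD : ∀ v, D.inl v = v) (W : V →L[ℂ] V) : D.diag W = compress K W := by
  ext1 w
  refine ext_inner_left ℂ fun v => ?_
  rw [inner_compress, D.inner_diag, ← hD v, ← hD w]
  rfl

theorem SymRep.Splitting.diag_compress {ρ : SymRep S V} {K K₁ : Submodule ℂ V} [CompleteSpace K]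
    [CompleteSpace K₁] {hK : ρ.Leaves K} {hK₁ : ρ.Leaves K₁} {ρ₂ : SymRep S V₂}
    (D : (ρ.restrict K hK).Splitting (ρ.restrict K₁ hK₁) ρ₂) (hD : ∀ v, (D.inl v : V) = v)
    (W : V →L[ℂ] V) : D.diag (compress K W) = compress K₁ W := by
  ext1 w
  refine ext_inner_left ℂ fun v => ?_
  rw [inner_compress, D.inner_diag, inner_compress, ← hD v, ← hD w]
  rfl

/-- Splitting off a finite-dimensional balanced summand does not change the index of a
compression. -/
theorem SymRep.Splitting.si_compress_eq {ρ : SymRep S V} {K K₁ : Submodule ℂ V} [CompleteSpace K]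
    [CompleteSpace K₁] {hK : ρ.Leaves K} {hK₁ : ρ.Leaves K₁} [FiniteDimensional ℂ V₂]
    {ρ₂ : SymRep S V₂} (D : (ρ.restrict K hK).Splitting (ρ.restrict K₁ hK₁) ρ₂)
    (hD : ∀ v, (D.inl v : V) = v) (hbal : ρ₂.IsBalanced) {W : V →L[ℂ] V}
    (hW : IsAdmissible (ρ.restrict K hK) (compress K W)) :
    si (ρ.restrict K hK) (compress K W) = si (ρ.restrict K₁ hK₁) (compress K₁ W) := by
  have := FiniteDimensional.proper ℂ V₂
  have := FiniteDimensional.complete ℂ V₂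
  have h₁ : IsCompactOperator (D.offdiag (compress K W)) :=
    isCompactOperator_of_locallyCompactSpace_dom _
  have h₂ : IsCompactOperator (D.swap.offdiag (compress K W)) :=
    isCompactOperator_of_locallyCompactSpace_rng _
  rw [D.si_eq_add hW h₁ h₂, hbal.si_eq_zero (D.swap.isAdmissible_diag hW h₂ h₁), add_zero,
    D.diag_compress hD]

theorem continuous_compress (K : Submodule ℂ V) [K.HasOrthogonalProjection] :
    Continuous (compress K : (V →L[ℂ] V) → _) := by
  unfold compress
  exact continuous_const.clm_comp (continuous_id.clm_comp continuous_const)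

theorem compress_sub (K : Submodule ℂ V) [K.HasOrthogonalProjection] (W W' : V →L[ℂ] V) :
    compress K (W - W') = compress K W - compress K W' := by
  ext v
  simp [compress]

theorem isCompactOperator_compress (K : Submodule ℂ V) [K.HasOrthogonalProjection] {W : V →L[ℂ] V}
    (hW : IsCompactOperator W) : IsCompactOperator (compress K W) :=
  (hW.comp_clm K.subtypeL).clm_comp K.orthogonalProjectionOnto

end

namespace LatticeSystem

variable {S : SymType} {H : Type u} [NormedAddCommGroup H] [InnerProductSpace ℂ H]
  (L : LatticeSystem S H)

/-! ### Geometry of the lattice system -/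

instance finiteDimensional_cell (x : ℤ) : FiniteDimensional ℂ (L.cell x) := L.finite x

theorem cell_le_cellSpan {I : Set ℤ} {x : ℤ} (hx : x ∈ I) : L.cell x ≤ L.cellSpan I :=
  (le_iSup₂_of_le (f := fun x (_ : x ∈ I) => L.cell x) x hx le_rfl).trans
    (Submodule.le_topologicalClosure _)

theorem cellSpan_le {I : Set ℤ} {K : Submodule ℂ H} (hK : IsClosed (K : Set H))
    (h : ∀ x ∈ I, L.cell x ≤ K) : L.cellSpan I ≤ K :=
  Submodule.topologicalClosure_minimal _ (iSup₂_le h) hK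

theorem cellSpan_mono {I J : Set ℤ} (h : I ⊆ J) : L.cellSpan I ≤ L.cellSpan J :=
  L.cellSpan_le (Submodule.isClosed_topologicalClosure _) fun _ hx => L.cell_le_cellSpan (h hx)

theorem cell_isOrtho_cellSpan {I : Set ℤ} {x : ℤ} (hx : x ∉ I) : L.cell x ⟂ L.cellSpan I := by
  rw [Submodule.isOrtho_comm]
  refine L.cellSpan_le (Submodule.isClosed_orthogonal _) fun y hy v hv w hw => ?_
  exact L.orthogonal (fun h : x = y => hx (h.symm ▸ hy)) ⟨w, hw⟩ ⟨v, hv⟩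

theorem cellSpan_isOrtho {I J : Set ℤ} (h : Disjoint I J) : L.cellSpan I ⟂ L.cellSpan J :=
  L.cellSpan_le (Submodule.isClosed_orthogonal _) fun _ hx =>
    L.cell_isOrtho_cellSpan (Set.disjoint_left.1 h hx)

theorem mem_cellSpan_orthogonal {I : Set ℤ} {v : H} (h : ∀ x ∈ I, v ∈ (L.cell x)ᗮ) :
    v ∈ (L.cellSpan I)ᗮ := by
  rw [Submodule.mem_orthogonal']
  intro w hw
  -- The orthogonal complement of v is closed and contains every cell with index in I, hence
  -- contains their closed span.
  have h2 := L.cellSpan_le (I := I) (Submodule.isClosed_orthogonal (Submodule.span ℂ {v}))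
    (fun x hx u hu => Submodule.mem_orthogonal_singleton_iff_inner_right.2
      (Submodule.inner_left_of_mem_orthogonal hu (h x hx))) hw
  exact Submodule.mem_orthogonal_singleton_iff_inner_right.1 h2

variable [CompleteSpace H]

theorem eq_zero_of_mem_cell_orthogonal {v : H} (h : ∀ x, v ∈ (L.cell x)ᗮ) : v = 0 := by
  have h1 : v ∈ (L.cellSpan Set.univ)ᗮ := L.mem_cellSpan_orthogonal fun x _ => h x
  have h2 : L.cellSpan Set.univ = ⊤ := by
    rw [← L.dense, cellSpan]
    simp
  rw [h2, Submodule.top_orthogonal_eq_bot] at h1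
  exact h1

/-- The splitting of `H` into the two half-spaces. -/
def splitting (a : ℤ) : L.rep.Splitting (L.repLt a) (L.repGe a) :=
  .ofOrthogonal (L.lt a).subtypeₗᵢ (L.ge a).subtypeₗᵢ (fun _ _ _ => rfl) (fun _ _ _ => rfl)
    (fun v w => L.cellSpan_isOrtho (Set.Iio_disjoint_Ici le_rfl) |>.inner_eq v.2 w.2)
    fun r hl hr => L.eq_zero_of_mem_cell_orthogonal fun x v hv => by
      rcases lt_or_ge x a with h | h
      · exact hl ⟨v, L.cell_le_cellSpan (Set.mem_Iio.2 h) hv⟩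
      · exact hr ⟨v, L.cell_le_cellSpan (Set.mem_Ici.2 h) hv⟩

/-- Adding a cell does not change the index of a compression. -/
theorem si_compress_insert {W : H →L[ℂ] H} {I J : Set ℤ} {a : ℤ} (hJ : J = insert a I) (ha : a ∉ I)
    (hW : IsAdmissible (L.rep.restrict (L.cellSpan J) (L.leaves_cellSpan J))
      (compress (L.cellSpan J) W)) :
    si (L.rep.restrict (L.cellSpan J) (L.leaves_cellSpan J)) (compress (L.cellSpan J) W) =
      si (L.rep.restrict (L.cellSpan I) (L.leaves_cellSpan I)) (compress (L.cellSpan I) W) := by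
  have hI : L.cellSpan I ≤ L.cellSpan J := L.cellSpan_mono (hJ ▸ Set.subset_insert a I)
  have hc : L.cell a ≤ L.cellSpan J := L.cell_le_cellSpan (hJ ▸ Set.mem_insert a I)
  have hzero : ∀ r ∈ L.cellSpan J, r ∈ (L.cellSpan I)ᗮ → r ∈ (L.cell a)ᗮ → r = 0 := by
    intro r hr hrI hra
    have h1 : r ∈ (L.cellSpan J)ᗮ := L.mem_cellSpan_orthogonal fun x hx => by
      rw [hJ] at hx
      rcases hx with rfl | hx
      · exact hra
      · exact Submodule.orthogonal_le (L.cell_le_cellSpan hx) hrI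
    exact inner_self_eq_zero.1 (h1 r hr)
  exact SymRep.Splitting.si_compress_eq (L.rep.splittingOfLE _ _ (L.leaves_cell a) hI hc
    (L.cell_isOrtho_cellSpan ha).symm hzero) (L.rep.coe_splittingOfLE_inl _ _ _ _ _ _ _)
    (L.balanced a) hW

theorem starProjection_ge (a : ℤ) :
    (L.ge a).starProjection = 1 - (L.lt a).starProjection := by
  ext v
  obtain ⟨x, y, h⟩ := (L.splitting a).exists_eq v
  have h' : v = (x : H) + y := h
  have hxy := L.cellSpan_isOrtho (Set.Iio_disjoint_Ici (le_refl a))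
  have h1 : (L.lt a).starProjection v = x :=
    Submodule.eq_starProjection_of_mem_orthogonal' x.2 (hxy.symm y.2) h'
  have h2 : (L.ge a).starProjection v = y :=
    Submodule.eq_starProjection_of_mem_orthogonal' y.2 (hxy x.2) (h'.trans (add_comm _ _))
  rw [sub_apply, one_apply_eq_self, h1, h2, h', add_sub_cancel_left]

theorem Iio_add_one_eq_insert (a : ℤ) : Set.Iio (a + 1) = insert a (Set.Iio a) := by
  ext x
  simp only [Set.mem_Iio, Set.mem_insert_iff]
  omega

theorem Ici_eq_insert (a : ℤ) : Set.Ici a = insert a (Set.Ici (a + 1)) := by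
  ext x
  simp only [Set.mem_Ici, Set.mem_insert_iff]
  omega

/-- The difference is the orthogonal projection onto the finite-dimensional cell at a. -/
theorem isCompactOperator_starProjection_lt_succ_sub (a : ℤ) :
    IsCompactOperator ((L.lt (a + 1)).starProjection - (L.lt a).starProjection : H →L[ℂ] H) := by
  have e : (L.lt (a + 1)).starProjection - (L.lt a).starProjection = (L.cell a).starProjection := by
    rw [sub_eq_iff_eq_add']
    ext v
    have hlt : L.lt a ≤ L.lt (a + 1) := L.cellSpan_mono (Set.Iio_subset_Iio (by omega))
    have hc : L.cell a ≤ L.lt (a + 1) := L.cell_le_cellSpan (Set.mem_Iio.2 (by omega))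
    have ho : L.cell a ⟂ L.lt a := L.cell_isOrtho_cellSpan Set.self_notMem_Iio
    have h1 := (L.lt a).sub_starProjection_mem_orthogonal v
    have h2 := (L.cell a).sub_starProjection_mem_orthogonal v
    have h3 : (L.cell a).starProjection v ∈ (L.lt a)ᗮ := ho ((L.cell a).starProjection_apply_mem v)
    have h4 : (L.lt a).starProjection v ∈ (L.cell a)ᗮ :=
      ho.symm ((L.lt a).starProjection_apply_mem v)
    refine Submodule.eq_starProjection_of_mem_orthogonal
      (add_mem (hlt ((L.lt a).starProjection_apply_mem v))
        (hc ((L.cell a).starProjection_apply_mem v))) (L.mem_cellSpan_orthogonal fun x hx => ?_)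
    change v - ((L.lt a).starProjection v + (L.cell a).starProjection v) ∈ _
    rcases (Int.lt_add_one_iff.1 hx).lt_or_eq with h | rfl
    · rw [← sub_sub]
      exact Submodule.orthogonal_le (L.cell_le_cellSpan (Set.mem_Iio.2 h)) (sub_mem h1 h3)
    · rw [add_comm, ← sub_sub]
      exact sub_mem h2 h4
  rw [e]
  have := FiniteDimensional.proper ℂ (L.cell a)
  have hp : IsCompactOperator (L.cell a).orthogonalProjectionOnto :=
    isCompactOperator_of_locallyCompactSpace_dom _
  exact hp.clm_comp (L.cell a).subtypeL

theorem isCompactOperator_starProjection_lt_sub (a b : ℤ) :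
    IsCompactOperator ((L.lt b).starProjection - (L.lt a).starProjection : H →L[ℂ] H) := by
  refine Int.inductionOn' b a ?_ (fun b _ ih => ?_) fun b _ ih => ?_
  · rw [sub_self]
    exact isCompactOperator_zero
  · simpa using (L.isCompactOperator_starProjection_lt_succ_sub b).add ih
  · have h := L.isCompactOperator_starProjection_lt_succ_sub (b - 1)
    rw [sub_add_cancel] at h
    simpa using ih.sub h

/-- Moving the cut changes the half-space projections by compact operators only, so essential
locality at one cut implies it at every cut. -/
theorem IsEssLocal.isCompactOperator {W : H →L[ℂ] H} (hW : L.IsEssLocal W) (b : ℤ) :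
    IsCompactOperator ((L.ge b).starProjection * W * (L.lt b).starProjection) ∧
      IsCompactOperator ((L.lt b).starProjection * W * (L.ge b).starProjection) := by
  obtain ⟨a, h₁, h₂⟩ := hW
  have hF := L.isCompactOperator_starProjection_lt_sub a b
  rw [starProjection_ge] at h₁ h₂ ⊢
  set P := (L.lt a).starProjection
  set Q := (L.lt b).starProjection
  constructor
  · rw [show (1 - Q) * W * Q = (1 - P) * W * P + (1 - P) * W * (Q - P) - (Q - P) * (W * Q) by
      noncomm_ring]
    exact (h₁.add (hF.clm_comp ((1 - P) * W))).sub (hF.comp_clm (W * Q))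
  · rw [show Q * W * (1 - Q) = P * W * (1 - P) + (Q - P) * (W * (1 - Q)) - P * W * (Q - P) by
      noncomm_ring]
    exact (h₂.add (hF.comp_clm (W * (1 - Q)))).sub (hF.clm_comp (P * W))

end LatticeSystem

end

end SymWalk

namespace SymWalk

noncomputable section

universe u

set_option linter.unusedSectionVars false

open ContinuousLinearMap (adjoint)

namespace LatticeSystem

variable {S : SymType} {H : Type u} [NormedAddCommGroup H] [InnerProductSpace ℂ H]
  (L : LatticeSystem S H) [CompleteSpace H]

/-! ### Half-space indices -/

theorem diag_splitting (a : ℤ) (W : H →L[ℂ] H) :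
    (L.splitting a).diag W = compress (L.lt a) W :=
  (L.splitting a).diag_eq_compress (hK := L.leaves_cellSpan _) (fun _ => rfl) W

theorem diag_swap_splitting (a : ℤ) (W : H →L[ℂ] H) :
    (L.splitting a).swap.diag W = compress (L.ge a) W :=
  (L.splitting a).swap.diag_eq_compress (hK := L.leaves_cellSpan _) (fun _ => rfl) W

theorem IsEssLocal.isCompactOperator_offdiag {W : H →L[ℂ] H} (hW : L.IsEssLocal W) (a : ℤ) :
    IsCompactOperator ((L.splitting a).offdiag W) ∧
      IsCompactOperator ((L.splitting a).swap.offdiag W) := by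
  obtain ⟨h₁, h₂⟩ := hW.isCompactOperator L a
  have key : ∀ (K K' : Submodule ℂ H) [K.HasOrthogonalProjection] [K'.HasOrthogonalProjection]
      (v : K) (w : K'), inner ℂ w (K'.orthogonalProjectionOnto
        ((K'.starProjection * W * K.starProjection) v)) = inner ℂ (w : H) (W v) := by
    intro K K' _ _ v w
    rw [K'.inner_orthogonalProjectionOnto_eq_of_mem_left, mul_apply_eq_comp, mul_apply_eq_comp,
      ← K'.inner_starProjection_left_eq_right, K'.starProjection_mem_subspace_eq_self,
      K.starProjection_mem_subspace_eq_self]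
  constructor
  · have e : (L.splitting a).offdiag W = (L.ge a).orthogonalProjectionOnto ∘L
        ((L.ge a).starProjection * W * (L.lt a).starProjection) ∘L (L.lt a).subtypeL := by
      ext1 v
      refine ext_inner_left ℂ fun w => ?_
      exact (ContinuousLinearMap.adjoint_inner_right (L.splitting a).swap.incl w _).trans
        (key _ _ v w).symm
    rw [e]
    exact (h₁.comp_clm (L.lt a).subtypeL).clm_comp (L.ge a).orthogonalProjectionOnto
  · have e : (L.splitting a).swap.offdiag W = (L.lt a).orthogonalProjectionOnto ∘L
        ((L.lt a).starProjection * W * (L.ge a).starProjection) ∘L (L.ge a).subtypeL := by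
      ext1 v
      refine ext_inner_left ℂ fun w => ?_
      exact (ContinuousLinearMap.adjoint_inner_right (L.splitting a).incl w _).trans
        (key _ _ v w).symm
    rw [e]
    exact (h₂.comp_clm (L.ge a).subtypeL).clm_comp (L.lt a).orthogonalProjectionOnto

theorem IsWalk.isAdmissible_compress {W : H →L[ℂ] H} (hW : L.IsWalk W) (a : ℤ) :
    IsAdmissible (L.repLt a) (compress (L.lt a) W) ∧
      IsAdmissible (L.repGe a) (compress (L.ge a) W) := by
  obtain ⟨h₁, h₂⟩ := hW.2.isCompactOperator_offdiag L a
  rw [← diag_splitting, ← diag_swap_splitting]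
  exact ⟨(L.splitting a).isAdmissible_diag hW.1 h₁ h₂,
    (L.splitting a).swap.isAdmissible_diag hW.1 h₂ h₁⟩

theorem IsWalk.si_eq_add {W : H →L[ℂ] H} (hW : L.IsWalk W) (a : ℤ) :
    si L.rep W = L.siLeft a W + L.siRight a W := by
  obtain ⟨h₁, h₂⟩ := hW.2.isCompactOperator_offdiag L a
  rw [siLeft, siRight, ← diag_splitting, ← diag_swap_splitting]
  exact (L.splitting a).si_eq_add hW.1 h₁ h₂

theorem IsWalk.siLeft_eq {W : H →L[ℂ] H} (hW : L.IsWalk W) (a b : ℤ) :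
    L.siLeft a W = L.siLeft b W := by
  have hstep : ∀ c, L.siLeft (c + 1) W = L.siLeft c W := fun c =>
    L.si_compress_insert (Iio_add_one_eq_insert c) Set.self_notMem_Iio
      (hW.isAdmissible_compress L (c + 1)).1
  refine Int.inductionOn' a b rfl (fun c _ ih => (hstep c).trans ih) fun c _ ih => ?_
  rw [← hstep, sub_add_cancel, ih]

theorem IsWalk.siRight_eq {W : H →L[ℂ] H} (hW : L.IsWalk W) (a b : ℤ) :
    L.siRight a W = L.siRight b W := by
  have hstep : ∀ c, L.siRight c W = L.siRight (c + 1) W := fun c =>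
    L.si_compress_insert (Ici_eq_insert c) (by simp) (hW.isAdmissible_compress L c).2
  refine Int.inductionOn' a b rfl (fun c _ ih => (hstep c).symm.trans ih) fun c _ ih => ?_
  rw [hstep, sub_add_cancel, ih]

/-! ### Perturbations -/

/-- Compression is norm-continuous and sends walks to admissible operators, so it turns a path of
walks into an admissible path on each half-space. -/
theorem IsGentlePerturbation.si_eq {W W' : H →L[ℂ] H} (h : L.IsGentlePerturbation W W') :
    si L.rep W' = si L.rep W ∧
      ∀ a, L.siLeft a W' = L.siLeft a W ∧ L.siRight a W' = L.siRight a W := by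
  obtain ⟨w, rfl, rfl, hw⟩ := h
  refine ⟨si_eq_of_path w w.continuous fun t => (hw t).1, fun a => ⟨?_, ?_⟩⟩
  · exact si_eq_of_path (fun t => compress (L.lt a) (w t))
      ((continuous_compress _).comp w.continuous) fun t => ((hw t).isAdmissible_compress L a).1
  · exact si_eq_of_path (fun t => compress (L.ge a) (w t))
      ((continuous_compress _).comp w.continuous) fun t => ((hw t).isAdmissible_compress L a).2

theorem IsCompactPerturbation.si_eq {W W' : H →L[ℂ] H} (h : L.IsCompactPerturbation W W') :
    si L.rep W' = si L.rep W ∧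
      ∀ a, L.siLeft a W' = L.siLeft a W ∧ L.siRight a W' = L.siRight a W := by
  obtain ⟨hW, hW', hc⟩ := h
  refine ⟨hW.1.si_eq_of_compact hW'.1 hc, fun a => ⟨?_, ?_⟩⟩
  · refine (hW.isAdmissible_compress L a).1.si_eq_of_compact (hW'.isAdmissible_compress L a).1 ?_
    rw [← compress_sub]
    exact isCompactOperator_compress _ hc
  · refine (hW.isAdmissible_compress L a).2.si_eq_of_compact (hW'.isAdmissible_compress L a).2 ?_
    rw [← compress_sub]
    exact isCompactOperator_compress _ hc

theorem IsLocalPerturbation.isCompactPerturbation {W W' : H →L[ℂ] H}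
    (h : L.IsLocalPerturbation W W') : L.IsCompactPerturbation W W' := by
  obtain ⟨hW, hW', hfin⟩ := h
  refine ⟨hW, hW', ?_⟩
  obtain ⟨a, ha⟩ := hfin.bddBelow
  obtain ⟨b, hb⟩ := hfin.bddAbove
  set X := W' - W
  have hX : ∀ I : Set ℤ, (∀ x ∈ I, ∀ v ∈ L.cell x, X v = 0) →
      X * (L.cellSpan I).starProjection = 0 := by
    intro I hI
    ext v
    exact L.cellSpan_le X.isClosed_ker hI ((L.cellSpan I).starProjection_apply_mem v)
  have h₁ : X * (L.lt a).starProjection = 0 := hX _ fun x hx v hv => by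
    by_contra h
    exact (ha ⟨v, hv, h⟩).not_gt hx
  -- The last cell on which X may be non-zero can be b itself, so vanishing is guaranteed only from
  -- b + 1 onwards.
  have h₂ : X * (L.ge (b + 1)).starProjection = 0 := hX _ fun x hx v hv => by
    by_contra h
    exact (hb ⟨v, hv, h⟩).not_gt (Int.add_one_le_iff.1 hx)
  have e : X = X * ((L.lt (b + 1)).starProjection - (L.lt a).starProjection) := by
    rw [starProjection_ge] at h₂
    rw [mul_sub, h₁, sub_zero]
    rwa [mul_sub, mul_one, sub_eq_zero] at h₂
  rw [e]
  exact (L.isCompactOperator_starProjection_lt_sub a (b + 1)).clm_comp X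

theorem compress_directSum (a : ℤ) (WL : L.lt a →L[ℂ] L.lt a) (WR : L.ge a →L[ℂ] L.ge a) :
    compress (L.lt a) (L.directSum a WL WR) = WL ∧
      compress (L.ge a) (L.directSum a WL WR) = WR := by
  have horth := L.cellSpan_isOrtho (Set.Iio_disjoint_Ici (le_refl a))
  constructor
  · ext1 v
    refine ext_inner_left ℂ fun w => ?_
    rw [inner_compress]
    simp [directSum, horth.inner_eq]
  · ext1 v
    refine ext_inner_left ℂ fun w => ?_
    rw [inner_compress]
    simp [directSum, horth.symm.inner_eq]

/-! ### Translation invariance -/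

/-- The shift has an eigenvector v in a non-trivial kernel, with eigenvalue of modulus one. For w in
a cell, the translates of w are mutually orthogonal, yet all have overlap of the same modulus with
v; Bessel's inequality makes this modulus zero. -/
theorem imKer_eq_bot_of_translationInvariant {W : H →L[ℂ] H} (hW : IsAdmissible L.rep W)
    (hT : L.IsTranslationInvariant W) : imKer W = ⊥ := by
  obtain ⟨T, hcell, -, hWT⟩ := hT
  have hWT' : ∀ v, adjoint W (T v) = T (adjoint W v) := by
    intro v
    refine ext_inner_right ℂ fun u => ?_
    obtain ⟨u, rfl⟩ := T.surjective u
    rw [ContinuousLinearMap.adjoint_inner_left, hWT, T.inner_map_map, T.inner_map_map,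
      ContinuousLinearMap.adjoint_inner_left]
  have hmap : ∀ v ∈ imKer W, T.toLinearEquiv.toLinearMap v ∈ imKer W := by
    intro v hv
    rw [mem_imKer] at hv ⊢
    change W (T v) = adjoint W (T v)
    rw [hWT, hWT', hv]
  have := hW.finite_imKer
  by_contra hne
  have : Nontrivial (imKer W) := Submodule.nontrivial_iff_ne_bot.2 hne
  obtain ⟨μ, hμ⟩ := Module.End.exists_eigenvalue (T.toLinearEquiv.toLinearMap.restrict hmap)
  obtain ⟨v, hv⟩ := hμ.exists_hasEigenvector
  have hTv : T v = μ • (v : H) := congrArg Subtype.val hv.apply_eq_smul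
  have hv0 : (v : H) ≠ 0 := fun h => hv.2 (Subtype.ext h)
  have hnorm : ‖μ‖ = 1 := by
    have h := T.norm_map (v : H)
    rw [hTv, norm_smul] at h
    exact (mul_eq_right₀ (norm_ne_zero_iff.2 hv0)).1 h
  refine hv0 (L.eq_zero_of_mem_cell_orthogonal fun x w hw => ?_)
  by_cases hw0 : w = 0
  · rw [hw0, inner_zero_left]
  have hiter : ∀ n : ℕ, T^[n] w ∈ L.cell (x + n) ∧ ‖T^[n] w‖ = ‖w‖ ∧
      ‖(inner ℂ (T^[n] w) (v : H) : ℂ)‖ = ‖(inner ℂ w (v : H) : ℂ)‖ := by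
    intro n
    induction n with
    | zero => simpa using hw
    | succ n ih =>
      obtain ⟨h1, h2, h3⟩ := ih
      rw [Function.iterate_succ_apply']
      refine ⟨?_, by rw [T.norm_map, h2], ?_⟩
      · push_cast
        rw [← add_assoc, ← hcell]
        exact Submodule.mem_map_of_mem h1
      · rw [← h3, ← T.inner_map_map (T^[n] w) (v : H), hTv, inner_smul_right, norm_mul, hnorm,
          one_mul]
  have horth : Orthonormal ℂ fun n : ℕ => ((‖w‖⁻¹ : ℝ) : ℂ) • T^[n] w := by
    refine ⟨fun n => ?_, fun n m hnm => ?_⟩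
    · rw [norm_smul, (hiter n).2.1]
      simp [hw0]
    · have hne : x + (n : ℤ) ≠ x + m := fun h => hnm (by omega)
      have h := L.orthogonal hne ⟨_, (hiter n).1⟩ ⟨_, (hiter m).1⟩
      change inner ℂ (T^[n] w) (T^[m] w) = 0 at h
      change inner ℂ (_ • T^[n] w) (_ • T^[m] w) = 0
      rw [inner_smul_left, inner_smul_right, h, mul_zero, mul_zero]
  -- The Bessel series has constant terms, so it is summable only if they vanish.
  have hsum := horth.inner_products_summable (v : H)
  simp only [inner_smul_left, norm_mul, (hiter _).2.2, summable_const_iff] at hsum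
  simpa [hw0] using hsum

theorem si_eq_zero_of_translationInvariant {W : H →L[ℂ] H} (hW : IsAdmissible L.rep W)
    (hT : L.IsTranslationInvariant W) : si L.rep W = 0 := by
  have := hW.finite_imKer
  have hsub : Subsingleton (imKer W) := by
    rw [L.imKer_eq_bot_of_translationInvariant hW hT]
    infer_instance
  rw [hW.si_eq]
  exact FinRep.cls_eq_zero (SymRep.isBalanced_of_subsingleton _)

end LatticeSystem

end

end SymWalk

theorem mainTheorem4 {S : SymWalk.SymType} {H : Type*} [NormedAddCommGroup H]
    [InnerProductSpace ℂ H] [CompleteSpace H] (L : SymWalk.LatticeSystem S H)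
    (W : H →L[ℂ] H) (hW : L.IsWalk W) :
    -- the half-space operators are admissible, so that their indices are defined
    (∀ a : ℤ, SymWalk.IsAdmissible (L.repLt a) (SymWalk.compress (L.lt a) W) ∧
      SymWalk.IsAdmissible (L.repGe a) (SymWalk.compress (L.ge a) W)) ∧
    -- invariance under gentle and compact perturbations
    (∀ W' : H →L[ℂ] H, L.IsGentlePerturbation W W' ∨ L.IsCompactPerturbation W W' →
      SymWalk.si L.rep W' = SymWalk.si L.rep W ∧
      ∀ a : ℤ, L.siLeft a W' = L.siLeft a W ∧ L.siRight a W' = L.siRight a W) ∧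
    -- the index is the sum of the left and the right index
    (∀ a : ℤ, SymWalk.si L.rep W = L.siLeft a W + L.siRight a W) ∧
    -- independence of the cut point
    (∀ a b : ℤ, L.siLeft a W = L.siLeft b W ∧ L.siRight a W = L.siRight b W) ∧
    -- agreement with decoupled local perturbations
    (∀ (a : ℤ) (WL : L.lt a →L[ℂ] L.lt a) (WR : L.ge a →L[ℂ] L.ge a),
      L.IsLocalPerturbation W (L.directSum a WL WR) →
      SymWalk.IsAdmissible (L.repLt a) WL ∧ SymWalk.IsAdmissible (L.repGe a) WR ∧
      ∀ b : ℤ, L.siLeft b W = SymWalk.si (L.repLt a) WL ∧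
        L.siRight b W = SymWalk.si (L.repGe a) WR) ∧
    -- translation invariant walks have vanishing index
    (L.IsTranslationInvariant W → SymWalk.si L.rep W = 0) := by
  refine ⟨hW.isAdmissible_compress L, fun W' h => h.elim (fun h => h.si_eq L) fun h => h.si_eq L,
    hW.si_eq_add L, fun a b => ⟨hW.siLeft_eq L a b, hW.siRight_eq L a b⟩, fun a WL WR h => ?_,
    L.si_eq_zero_of_translationInvariant hW.1⟩
  -- Compressing the decoupled walk at its own cut a returns `WL` and `WR`. Invariance under compact
  -- perturbations compares the indices at a, and independence of the cut carries the result to b.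
  obtain ⟨hL, hR⟩ := L.compress_directSum a WL WR
  have hadm := h.2.1.isAdmissible_compress L a
  have hsi := ((h.isCompactPerturbation L).si_eq L).2 a
  rw [hL, hR] at hadm
  rw [SymWalk.LatticeSystem.siLeft, SymWalk.LatticeSystem.siRight, hL, hR] at hsi
  exact ⟨hadm.1, hadm.2, fun b =>
    ⟨(hW.siLeft_eq L b a).trans hsi.1.symm, (hW.siRight_eq L b a).trans hsi.2.symm⟩⟩
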